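/- Let $n\ge 1$ and let $\mathbf R^{1,n}=\mathbf R\times\mathbf R^n$ be Minkowski space, with points $x=(t,p)$, flat Lorentzian metric $b=-dt^2+dp_1^2+\dots+dp_n^2$, time orientation $\partial_t$, Euclidean metric $h=dt^2+dp_1^2+\dots+dp_n^2$ with distance $d_h$, and, for $\varepsilon>0$, $b_\varepsilon=-(1+\varepsilon)^2dt^2+dp_1^2+\dots+dp_n^2$. Let $\Omega\subset\mathbf R^{1,n}$ be a domain (a non-empty, connected, proper open subset) that is causally convex: every piecewise smooth causal curve of $\mathbf R^{1,n}$ with endpoints in $\Omega$ is contained in $\Omega$. Let $U\subset\mathbf R^n$ be the projection of $\Omega$, and for $p\in U$ let $f_+(p)=\sup\{t : (t,p)\in\Omega\}$ and $f_-(p)=\inf\{t : (t,p)\in\Omega\}$. The future and past causal boundaries of $\Omega$ are the graphs $\partial_c^{\pm}\Omega=\{(f_\pm(p),p) : p\in U,\ f_\pm(p)\text{ finite}\}$. The Markowitz pseudodistance of $\Omega$ is $$\delta_\Omega(x,y)=\inf\sum_{k=1}^m\left|\ln\frac{(s_k-1)(t_k+1)}{(s_k+1)(t_k-1)}\right| ,$$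 the infimum being taken over all $m\ge1$, all projectively parametrized lightlike geodesics $\gamma_1,\dots,\gamma_m:(-1,1)\to\Omega$ and all $s_k,t_k\in(-1,1)$ such that $\gamma_1(s_1)=x$, $\gamma_m(t_m)=y$ and $\gamma_k(t_k)=\gamma_{k+1}(s_{k+1})$ for $1\le k<m$. Here a projectively parametrized lightlike geodesic of $\Omega$ is a curve $c\circ u^{-1}$, where $c(t)=a+tv$ with $v\neq0$, $b(v,v)=0$, is defined on an open interval $J$ and has values in $\Omega$, and where $u:J\to(-1,1)$ is a surjective smooth function with $u'\ne0$ and vanishing Schwarzian derivative $\frac{u'''}{u'}-\frac32\left(\frac{u''}{u'}\right)^2=0$. The quasi-hyperbolic distance $\mathrm k_\Omega(x,y)$ is the Riemannian distance of the metric $d_h(\cdot,\partial\Omega)^{-2}h$ on $\Omega$, that is, the infimum of the lengths for this metric of the piecewise smooth curves in $\Omega$ from $x$ to $y$. **Theorem.** Let $\varepsilon>0$, and assume that $\partial_c^+\Omega$ and $\partial_c^-\Omega$ are both $\varepsilon$-stably acausal: no two distinct points of the same one of these sets are joined by a piecewise smooth causal curve of $(\mathbf R^{1,n},b_\varepsilon)$.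 Then, for all $x,y\in\Omega$, the numbers $\mathrm k_\Omega(x,y)$ and $\delta_\Omega(x,y)$ are finite and $$\frac{\varepsilon}{\sqrt{(2+\varepsilon)^2+\varepsilon^2}}\,\mathrm k_\Omega(x,y)\ \le\ \delta_\Omega(x,y)\ \le\ 2\sqrt2\,\mathrm k_\Omega(x,y).$$ -/

import Mathlib

open scoped ENNReal ContDiff

noncomputable section

/-- Minkowski space `R^{1,n}` as `R × R^n`, a point being `x = (t, p)` with `t = x.fst` and
`p = x.snd`. The norm of this type is the Euclidean norm `√(t² + |p|²)`, that is, the norm of the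
Wick rotation `h = dt² + dσ²`; its distance is `d_h`. -/
abbrev Minkowski (n : ℕ) : Type := WithLp 2 (ℝ × EuclideanSpace ℝ (Fin n))

namespace Minkowski

variable {n : ℕ}

/-- The bilinear form `b_ε = -(1+ε)² dt² + dp₁² + ⋯ + dpₙ²`; for `ε = 0` this is the flat
Lorentzian metric `b`. -/
def form (ε : ℝ) (v w : Minkowski n) : ℝ :=
  -(1 + ε) ^ 2 * (v.fst * w.fst) + inner ℝ v.snd w.snd

/-- The unit timelike vector `∂_t`, which defines the time orientation. -/
def timeVector (n : ℕ) : Minkowski n := WithLp.toLp 2 (1, 0)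

/-- Lightlike vectors of the flat metric `b`. -/
def IsLightlike (v : Minkowski n) : Prop := v ≠ 0 ∧ form 0 v v = 0

/-- Future causal vectors of `b_ε`. -/
def IsFutureCausal (ε : ℝ) (v : Minkowski n) : Prop :=
  form ε v v ≤ 0 ∧ form ε v (timeVector n) < 0

/-- `t 0 < t 1 < ⋯ < t m` is a subdivision of `[a, b]`. -/
def IsSubdivision (a b : ℝ) (m : ℕ) (t : ℕ → ℝ) : Prop :=
  t 0 = a ∧ t m = b ∧ ∀ i < m, t i < t (i + 1)

/-- `γ` is a (continuous) piecewise smooth curve on `[a, b]`: it is smooth, up to the endpoints, on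
each of the closed intervals of some subdivision. -/
def IsPiecewiseSmooth (γ : ℝ → Minkowski n) (a b : ℝ) : Prop :=
  ∃ (m : ℕ) (t : ℕ → ℝ), IsSubdivision a b m t ∧
    ∀ i < m, ContDiffOn ℝ ∞ γ (Set.Icc (t i) (t (i + 1)))

/-- `γ` is a future causal curve of `b_ε` on `[a, b]`: a piecewise smooth curve whose velocity is
future causal everywhere (both one-sided velocities at a break point). -/
def IsFutureCausalCurve (ε : ℝ) (γ : ℝ → Minkowski n) (a b : ℝ) : Prop :=
  ∃ (m : ℕ) (t : ℕ → ℝ), IsSubdivision a b m t ∧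
    ∀ i < m, ContDiffOn ℝ ∞ γ (Set.Icc (t i) (t (i + 1))) ∧
      ∀ s ∈ Set.Icc (t i) (t (i + 1)),
        IsFutureCausal ε (derivWithin γ (Set.Icc (t i) (t (i + 1))) s)

/-- `x ≤ y` in `(R^{1,n}, [b_ε])`: some future causal curve goes from `x` to `y`. -/
def CausallyPrecedes (ε : ℝ) (x y : Minkowski n) : Prop :=
  ∃ (γ : ℝ → Minkowski n) (a b : ℝ), IsFutureCausalCurve ε γ a b ∧ γ a = x ∧ γ b = y

/-- A set is `ε`-stably acausal if no two distinct points of it are causally related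
in `(R^{1,n}, [b_ε])`. -/
def IsStablyAcausal (ε : ℝ) (C : Set (Minkowski n)) : Prop :=
  ∀ x ∈ C, ∀ y ∈ C, x ≠ y → ¬ CausallyPrecedes ε x y

/-- A domain is a non-empty, connected, proper open subset. -/
structure IsProperDomain (Ω : Set (Minkowski n)) : Prop where
  isOpen : IsOpen Ω
  isConnected : IsConnected Ω
  ne_univ : Ω ≠ Set.univ

/-- `Ω` is causally convex: every causal curve of `b` with endpoints in `Ω` stays in `Ω`. (Past
causal curves are future causal ones traversed backwards.) -/
def IsCausallyConvex (Ω : Set (Minkowski n)) : Prop :=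
  ∀ (γ : ℝ → Minkowski n) (a b : ℝ), IsFutureCausalCurve 0 γ a b → γ a ∈ Ω → γ b ∈ Ω →
    ∀ s ∈ Set.Icc a b, γ s ∈ Ω

/-- The projection `U` of `Ω` to `R^n`. -/
def shadow (Ω : Set (Minkowski n)) : Set (EuclideanSpace ℝ (Fin n)) :=
  {p | ∃ t : ℝ, WithLp.toLp 2 (t, p) ∈ Ω}

/-- `f_+(p) = sup {t | (t, p) ∈ Ω}`. -/
def upperHeight (Ω : Set (Minkowski n)) (p : EuclideanSpace ℝ (Fin n)) : EReal :=
  ⨆ (t : ℝ) (_ : WithLp.toLp 2 (t, p) ∈ Ω), (t : EReal)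

/-- `f_-(p) = inf {t | (t, p) ∈ Ω}`. -/
def lowerHeight (Ω : Set (Minkowski n)) (p : EuclideanSpace ℝ (Fin n)) : EReal :=
  ⨅ (t : ℝ) (_ : WithLp.toLp 2 (t, p) ∈ Ω), (t : EReal)

/-- The future causal boundary: the graph of `f_+` over `U`, empty where `f_+` is infinite. -/
def futureCausalBoundary (Ω : Set (Minkowski n)) : Set (Minkowski n) :=
  {x | x.snd ∈ shadow Ω ∧ (x.fst : EReal) = upperHeight Ω x.snd}

/-- The past causal boundary: the graph of `f_-` over `U`, empty where `f_-` is infinite. -/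
def pastCausalBoundary (Ω : Set (Minkowski n)) : Set (Minkowski n) :=
  {x | x.snd ∈ shadow Ω ∧ (x.fst : EReal) = lowerHeight Ω x.snd}

/-- The Schwarzian derivative `Su = u'''/u' - (3/2) (u''/u')²`. -/
def schwarzian (u : ℝ → ℝ) (t : ℝ) : ℝ :=
  iteratedDeriv 3 u t / deriv u t - 3 / 2 * (iteratedDeriv 2 u t / deriv u t) ^ 2

/-- `γ : (-1, 1) → Ω` is a projectively parametrized lightlike geodesic of `Ω`: it is `c ∘ u⁻¹`
where `c(t) = a + t v` is a lightlike geodesic of the flat metric, defined on an open interval `J`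
and with values in `Ω`, and `u : J → (-1, 1)` is a projective parameter along `c`. The metric being
flat, its Ricci curvature vanishes and the equation of projective parameters is `Su = 0`.
Only the values of `γ` on `(-1, 1)` matter. -/
def IsPPL (Ω : Set (Minkowski n)) (γ : ℝ → Minkowski n) : Prop :=
  ∃ (a v : Minkowski n) (J : Set ℝ) (u : ℝ → ℝ), IsLightlike v ∧
    IsOpen J ∧ J.OrdConnected ∧ (∀ t ∈ J, a + t • v ∈ Ω) ∧
    ContDiffOn ℝ ∞ u J ∧ (∀ t ∈ J, deriv u t ≠ 0) ∧ (∀ t ∈ J, schwarzian u t = 0) ∧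
    u '' J = Set.Ioo (-1) 1 ∧ ∀ t ∈ J, γ (u t) = a + t • v

/-- The distance `ρ_I` of the interval `I = (-1, 1)`. -/
def intervalDist (s t : ℝ) : ℝ :=
  |Real.log (((s - 1) * (t + 1)) / ((s + 1) * (t - 1)))|

/-- `((γ_k), (s_k), (t_k))`, `k = 0, …, m`, is a lightlike chain in `Ω` from `x` to `y`. -/
structure IsLightlikeChain (Ω : Set (Minkowski n)) (x y : Minkowski n) (m : ℕ)
    (γ : ℕ → ℝ → Minkowski n) (s t : ℕ → ℝ) : Prop where
  ppl : ∀ k ≤ m, IsPPL Ω (γ k)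
  left_mem : ∀ k ≤ m, s k ∈ Set.Ioo (-1 : ℝ) 1
  right_mem : ∀ k ≤ m, t k ∈ Set.Ioo (-1 : ℝ) 1
  source : γ 0 (s 0) = x
  target : γ m (t m) = y
  link : ∀ k < m, γ k (t k) = γ (k + 1) (s (k + 1))

/-- The Markowitz pseudodistance `δ_Ω`, as an infimum in `[0, ∞]`. -/
def markowitzDist (Ω : Set (Minkowski n)) (x y : Minkowski n) : ℝ≥0∞ :=
  ⨅ (m : ℕ) (γ : ℕ → ℝ → Minkowski n) (s : ℕ → ℝ) (t : ℕ → ℝ)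
    (_ : IsLightlikeChain Ω x y m γ s t),
    ∑ k ∈ Finset.range (m + 1), ENNReal.ofReal (intervalDist (s k) (t k))

/-- The length of `γ` on `[a, b]` for the quasi-hyperbolic metric `d_h(·, ∂Ω)⁻² h`. -/
def quasiHyperbolicLength (Ω : Set (Minkowski n)) (γ : ℝ → Minkowski n) (a b : ℝ) : ℝ≥0∞ :=
  ∫⁻ t in Set.Icc a b, ENNReal.ofReal (‖deriv γ t‖ / Metric.infDist (γ t) (frontier Ω))

/-- The quasi-hyperbolic distance `k_Ω`: the infimum, in `[0, ∞]`, of the lengths of the piecewise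
smooth curves in `Ω` from `x` to `y`. -/
def quasiHyperbolicDist (Ω : Set (Minkowski n)) (x y : Minkowski n) : ℝ≥0∞ :=
  ⨅ (γ : ℝ → Minkowski n) (a : ℝ) (b : ℝ)
    (_ : IsPiecewiseSmooth γ a b ∧ (∀ t ∈ Set.Icc a b, γ t ∈ Ω) ∧ γ a = x ∧ γ b = y),
    quasiHyperbolicLength Ω γ a b

end Minkowski

end

/-! Both inequalities come from comparing infinitesimal metrics and integrating.

Lower bound. Stable acausality makes the heights `f_+` and `f_-` Lipschitz with constant `l =
1/(1+ε) < 1`. If `z + v` and `z - v` lie in `Ω` with `v` lightlike, then `f_+` over the projection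
of `z + v` and `f_-` over that of `z - v` control both heights near `z`, and `Ω` contains a solid
double cone about `z` (`IsDiamondConvex.doubleCone_mem`). The Euclidean ball inscribed in that cone
gives `c ‖v‖ ≤ d_h(z, ∂Ω)`, where `c` is `lowerConst ε` (`lowerConst_mul_norm_le_infDist`). A
projective parameter `u` is a homography, so its domain contains the interval about `t` of radius
`(1 - u²)/(2|u'|)`, the inverse of the density of `ρ_I` (`add_mem_and_sub_mem`). Hence `c` times the
quasi-hyperbolic density is at most the density of `ρ_I` along each lightlike geodesic
(`IsPPL.segment`), and the estimates add up along a chain.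

Upper bound. In a Euclidean ball contained in `Ω`, lightlike diameters with affine parameter are
admissible geodesics. Every displacement is a sum of two lightlike ones, so `δ_Ω` grows at rate at
most `2√2 / d_h(·, ∂Ω)` (`markowitzDist_le_add_of_ball`). A comparison argument for right-hand
slopes integrates this along smooth curves (`markowitzDist_le_add_length`).

Finiteness of both distances follows from local finiteness and connectedness. -/

noncomputable section

open Set Filter Topology

namespace Minkowski

variable {n : ℕ}

/-! ### Double cones inside diamond-convex sets with Lipschitz heights. -/

section FibreSets

variable {E : Type*} [NormedAddCommGroup E]

/-- A family of subsets of the time axis indexed by `E` whose total space contains the closed causal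
diamond spanned by any two of its points. -/
def IsDiamondConvex (A : ℝ → E → Prop) : Prop :=
  ∀ t p t₁ p₁ t₂ p₂, A t₁ p₁ → A t₂ p₂ → ‖p - p₁‖ ≤ t - t₁ → ‖p₂ - p‖ ≤ t₂ - t → A t p

/-- The suprema of the fibres, where they are finite, form an `l`-Lipschitz function. -/
def HasLipschitzSup (l : ℝ) (A : ℝ → E → Prop) : Prop :=
  ∀ p q T T', IsLUB {t | A t p} T → IsLUB {t | A t q} T' → T' - T ≤ l * ‖q - p‖

theorem IsDiamondConvex.vertical {A : ℝ → E → Prop} (hA : IsDiamondConvex A) {p : E} {t₁ t t₂ : ℝ}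
    (h₁ : A t₁ p) (h₂ : A t₂ p) (h₁t : t₁ ≤ t) (ht₂ : t ≤ t₂) : A t p :=
  hA t p t₁ p t₂ p h₁ h₂ (by simpa using h₁t) (by simpa using ht₂)

theorem IsDiamondConvex.reflect {A : ℝ → E → Prop} (hA : IsDiamondConvex A) :
    IsDiamondConvex fun t p => A (-t) p := by
  intro t p t₁ p₁ t₂ p₂ h₁ h₂ h h'
  refine hA (-t) p (-t₂) p₂ (-t₁) p₁ h₂ h₁ ?_ ?_
  · rw [norm_sub_rev]; linarith
  · rw [norm_sub_rev]; linarith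

/-- If `(t, p)` were missing, `t` would bound the fibre over `p`. A point of the fibre over `q`
higher than `t + ‖q - p‖` would have in its causal past a point over `p` above `t`, so that fibre is
bounded too. Both suprema are then finite, and the Lipschitz bound contradicts `ht`. -/
theorem IsDiamondConvex.mem_of_lt {A : ℝ → E → Prop} (hA : IsDiamondConvex A) {l : ℝ}
    (hl : HasLipschitzSup l A) {t₀ t T : ℝ} {p q : E} (h₀ : A t₀ p) (hT : A T q)
    (ht₀ : t₀ ≤ t) (ht : t < T - l * ‖q - p‖) : A t p := by
  by_contra hn
  have bp : ∀ s, A s p → s ≤ t := fun s hs => by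
    by_contra! h
    exact hn (hA.vertical h₀ hs ht₀ h.le)
  have bq : ∀ s, A s q → s ≤ t + ‖q - p‖ := fun s hs => by
    by_contra! h
    refine hn (bp (s - ‖q - p‖) ?_ |>.not_gt (by linarith) |>.elim)
    exact hA _ p t₀ p s q h₀ hs (by simp; linarith) (by linarith)
  have lp : IsLUB {s | A s p} (sSup {s | A s p}) := isLUB_csSup ⟨t₀, h₀⟩ ⟨t, bp⟩
  have lq : IsLUB {s | A s q} (sSup {s | A s q}) := isLUB_csSup ⟨T, hT⟩ ⟨_, bq⟩
  have h1 := hl p q _ _ lp lq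
  have h2 : sSup {s | A s p} ≤ t := lp.2 bp
  have h3 : T ≤ sSup {s | A s q} := lq.1 hT
  linarith

variable [NormedSpace ℝ E]

/-- Over `p'` the upper height is at least `t + S - l (S + ‖p' - p‖) = t + (1 - l) S - l ‖p' - p‖`,
and symmetrically below. This needs a nonempty fibre over `p'`; connectedness of the base ball of
the cone then shows that all its fibres are nonempty. -/
theorem IsDiamondConvex.doubleCone_mem {A : ℝ → E → Prop} (hA : IsDiamondConvex A) {l : ℝ}
    (hl0 : 0 < l) (hl : HasLipschitzSup l A)
    (hl' : HasLipschitzSup l fun t p => A (-t) p)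
    (hopen : IsOpen {p | ∃ t, A t p})
    {t S : ℝ} {p q : E} (h : A t p) (hS : ‖q‖ ≤ S) (h₁ : A (t + S) (p + q))
    (h₂ : A (t - S) (p - q)) {t' : ℝ} {p' : E}
    (h' : |t' - t| + l * ‖p' - p‖ < (1 - l) * S) : A t' p' := by
  have key : ∀ p', (∃ t₀, A t₀ p') → ∀ t', |t' - t| + l * ‖p' - p‖ < (1 - l) * S → A t' p' := by
    rintro p' ⟨t₀, h₀⟩ t' h'
    have e₁ : ‖p + q - p'‖ ≤ S + ‖p' - p‖ := by
      calc ‖p + q - p'‖ = ‖q - (p' - p)‖ := by congr 1; abel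
        _ ≤ ‖q‖ + ‖p' - p‖ := norm_sub_le _ _
        _ ≤ _ := by linarith
    have e₂ : ‖p - q - p'‖ ≤ S + ‖p' - p‖ := by
      calc ‖p - q - p'‖ = ‖-q - (p' - p)‖ := by congr 1; abel
        _ ≤ ‖-q‖ + ‖p' - p‖ := norm_sub_le _ _
        _ ≤ _ := by rw [norm_neg]; linarith
    have e₁' := mul_le_mul_of_nonneg_left e₁ hl0.le
    have e₂' := mul_le_mul_of_nonneg_left e₂ hl0.le
    rcases le_total t₀ t' with hle | hle
    · refine hA.mem_of_lt hl h₀ h₁ hle ?_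
      have := le_abs_self (t' - t)
      linarith
    · have : (fun t p => A (-t) p) (-t') p' := by
        refine hA.reflect.mem_of_lt hl' (t₀ := -t₀) (T := -(t - S)) (q := p - q)
          (by simpa using h₀) (by simpa using h₂) (by linarith) ?_
        have := neg_abs_le (t' - t)
        linarith
      simpa using this
  refine key p' ?_ t' h'
  have hsub : Metric.ball p ((1 - l) * S / l) ⊆ {p | ∃ t, A t p} := by
    have hpos : 0 < (1 - l) * S / l := by
      have := abs_nonneg (t' - t)
      have := norm_nonneg (p' - p)
      have : 0 < (1 - l) * S := by nlinarith
      positivity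
    refine (Metric.isPreconnected_ball).subset_of_closure_inter_subset hopen
      ⟨p, Metric.mem_ball_self hpos, t, h⟩ ?_
    rintro r ⟨hr, hrb⟩
    rw [mem_ball_iff_norm, lt_div_iff₀ hl0] at hrb
    set d := (1 - l) * S - l * ‖r - p‖ with hd
    have hd0 : 0 < d := by rw [hd]; linarith
    -- The bound `d / (2 * l)` keeps `(t ± d/2, s)` inside the double cone; the bound `d / 2` puts
    -- `(t, r)` in the diamond between these two points.
    obtain ⟨s, hs, hsr⟩ := Metric.mem_closure_iff.1 hr (min (d / 2) (d / (2 * l))) (by positivity)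
    rw [dist_eq_norm] at hsr
    have hs1 : ‖r - s‖ < d / 2 := hsr.trans_le (min_le_left _ _)
    have hs2 : l * ‖r - s‖ < d / 2 := by
      have := hsr.trans_le (min_le_right _ _)
      rw [lt_div_iff₀ (by positivity)] at this
      linarith
    have htri : ‖s - p‖ ≤ ‖r - s‖ + ‖r - p‖ := by
      rw [norm_sub_rev r s]
      calc ‖s - p‖ = ‖(s - r) + (r - p)‖ := by congr 1; abel
        _ ≤ _ := norm_add_le _ _
    have htri' := mul_le_mul_of_nonneg_left htri hl0.le
    have hb : ∀ c, |c| = d / 2 → A (t + c) s := fun c hc => by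
      refine key s hs _ ?_
      rw [add_sub_cancel_left, hc]
      linarith
    refine ⟨t, hA t r (t + -(d / 2)) s (t + d / 2) s (hb _ ?_) (hb _ ?_) ?_ ?_⟩
    · rw [abs_neg, abs_of_pos (by positivity)]
    · rw [abs_of_pos (by positivity)]
    · linarith
    · rw [norm_sub_rev]; linarith
  refine hsub ?_
  rw [mem_ball_iff_norm, lt_div_iff₀ hl0]
  have := abs_nonneg (t' - t)
  linarith

end FibreSets

/-! ### Causal curves, causal diamonds and the Lipschitz property of the heights. -/

theorem norm_sq_eq (v : Minkowski n) : ‖v‖ ^ 2 = v.fst ^ 2 + ‖v.snd‖ ^ 2 := by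
  rw [WithLp.prod_norm_sq_eq_of_L2, Real.norm_eq_abs, sq_abs]

theorem ext_fst_snd {v w : Minkowski n} (h₁ : v.fst = w.fst) (h₂ : v.snd = w.snd) : v = w :=
  WithLp.ofLp_injective 2 (Prod.ext h₁ h₂)

theorem form_self (ε : ℝ) (v : Minkowski n) :
    form ε v v = ‖v.snd‖ ^ 2 - ((1 + ε) * v.fst) ^ 2 := by
  rw [form, real_inner_self_eq_norm_sq]; ring

theorem isFutureCausal_of_le {ε : ℝ} (hε : 0 ≤ ε) {v : Minkowski n} (h₀ : 0 < v.fst)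
    (h : ‖v.snd‖ ≤ (1 + ε) * v.fst) : IsFutureCausal ε v := by
  refine ⟨?_, ?_⟩
  · rw [form_self]
    have := pow_le_pow_left₀ (norm_nonneg _) h 2
    linarith
  · have h1 : form ε v (timeVector n) = -((1 + ε) ^ 2 * v.fst) := by simp [form, timeVector]
    rw [h1]
    exact neg_neg_of_pos (by positivity)

theorem hasDerivAt_segment (x v : Minkowski n) (c s : ℝ) :
    HasDerivAt (fun s : ℝ => x + (s - c) • v) v s := by
  simpa using (((hasDerivAt_id s).sub_const c).smul_const v).const_add x

theorem contDiff_segment (x v : Minkowski n) (c : ℝ) :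
    ContDiff ℝ ∞ (fun s : ℝ => x + (s - c) • v) := by
  fun_prop

theorem causallyPrecedes_of_le {ε : ℝ} (hε : 0 ≤ ε) {x y : Minkowski n} (h₀ : x.fst < y.fst)
    (h : ‖y.snd - x.snd‖ ≤ (1 + ε) * (y.fst - x.fst)) : CausallyPrecedes ε x y := by
  refine ⟨fun s => x + (s - 0) • (y - x), 0, 1, ⟨1, fun i => i, ⟨by simp, by simp, by simp⟩, ?_⟩,
    by simp, by simp⟩
  intro i hi
  refine ⟨(contDiff_segment _ _ _).contDiffOn, fun s hs => ?_⟩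
  rw [(hasDerivAt_segment x (y - x) 0 s).hasDerivWithinAt.derivWithin
    (uniqueDiffOn_Icc (by simp) s hs)]
  exact isFutureCausal_of_le hε (by simpa using h₀) (by simpa using h)

/-- The curve which follows `γ` up to the parameter `b`, then the straight line with velocity `v`. -/
def appendLine (γ : ℝ → Minkowski n) (b : ℝ) (v : Minkowski n) (s : ℝ) : Minkowski n :=
  if s ≤ b then γ s else γ b + (s - b) • v

theorem appendLine_of_le (γ : ℝ → Minkowski n) {b s : ℝ} (v : Minkowski n) (h : s ≤ b) :
    appendLine γ b v s = γ s := if_pos h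

theorem appendLine_of_ge (γ : ℝ → Minkowski n) {b s : ℝ} (v : Minkowski n) (h : b ≤ s) :
    appendLine γ b v s = γ b + (s - b) • v := by
  rcases h.eq_or_lt with rfl | h
  · simp [appendLine]
  · exact if_neg h.not_ge

/-- The broken line from `x` through `z` to `y` is causal. Future causal velocities are nonzero, so
a leg of zero length is treated apart: then `z` is an endpoint. -/
theorem mem_of_causal_le {Ω : Set (Minkowski n)} (hcc : IsCausallyConvex Ω) {x z y : Minkowski n}
    (hx : x ∈ Ω) (hy : y ∈ Ω) (h₁ : ‖z.snd - x.snd‖ ≤ z.fst - x.fst)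
    (h₂ : ‖y.snd - z.snd‖ ≤ y.fst - z.fst) : z ∈ Ω := by
  have trivial_case : ∀ {a b : Minkowski n}, ‖b.snd - a.snd‖ ≤ b.fst - a.fst → b.fst ≤ a.fst →
      b = a := fun {a b} h h' => by
    have h0 : b.fst - a.fst = 0 := le_antisymm (by linarith) ((norm_nonneg _).trans h)
    rw [h0] at h
    exact ext_fst_snd (by linarith) (sub_eq_zero.1 (norm_le_zero_iff.1 h))
  rcases le_or_gt z.fst x.fst with h | hxz
  · rwa [trivial_case h₁ h]
  rcases le_or_gt y.fst z.fst with h | hzy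
  · rwa [← trivial_case h₂ h]
  set c : ℝ → Minkowski n := appendLine (fun s => x + (s - 0) • (z - x)) 1 (y - z) with hc
  have c1 : EqOn c (fun s => x + (s - 0) • (z - x)) (Icc 0 1) := fun s hs =>
    appendLine_of_le _ _ hs.2
  have c2 : EqOn c (fun s => z + (s - 1) • (y - z)) (Icc 1 2) := fun s hs => by
    rw [hc, appendLine_of_ge _ _ hs.1]; simp
  have hz : c 1 = z := by rw [c1 (by simp)]; simp
  have := hcc c 0 2 ⟨2, fun i => i, ⟨by simp, by simp, by simp⟩, ?_⟩
    (by rw [c1 (by simp)]; simpa using hx) (by rw [c2 (by simp)]; norm_num; exact hy)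
    1 ⟨by norm_num, by norm_num⟩
  · rwa [hz] at this
  intro i hi
  have hi' : i = 0 ∨ i = 1 := by omega
  rcases hi' with rfl | rfl
  · norm_num
    refine ⟨(contDiff_segment x (z - x) 0).contDiffOn.congr c1, fun s h₀ h₁' => ?_⟩
    have hs : s ∈ Icc (0 : ℝ) 1 := ⟨h₀, h₁'⟩
    rw [derivWithin_congr c1 (c1 hs),
      (hasDerivAt_segment x (z - x) 0 s).hasDerivWithinAt.derivWithin
        (uniqueDiffOn_Icc (by simp) s hs)]
    exact isFutureCausal_of_le le_rfl (by simpa using hxz) (by simpa using h₁)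
  · norm_num
    refine ⟨(contDiff_segment z (y - z) 1).contDiffOn.congr c2, fun s h₀ h₁' => ?_⟩
    have hs : s ∈ Icc (1 : ℝ) 2 := ⟨h₀, h₁'⟩
    rw [derivWithin_congr c2 (c2 hs),
      (hasDerivAt_segment z (y - z) 1 s).hasDerivWithinAt.derivWithin
        (uniqueDiffOn_Icc (by simp) s hs)]
    exact isFutureCausal_of_le le_rfl (by simpa using hzy) (by simpa using h₂)

/-- Membership in `Ω` in terms of the two coordinates. -/
def fibreMem (Ω : Set (Minkowski n)) (t : ℝ) (p : EuclideanSpace ℝ (Fin n)) : Prop :=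
  WithLp.toLp 2 (t, p) ∈ Ω

theorem isDiamondConvex_fibreMem {Ω : Set (Minkowski n)} (hcc : IsCausallyConvex Ω) :
    IsDiamondConvex (fibreMem Ω) := fun _ _ _ _ _ _ h₁ h₂ h h' =>
  mem_of_causal_le hcc h₁ h₂ h h'

theorem upperHeight_eq_of_isLUB {Ω : Set (Minkowski n)} {p : EuclideanSpace ℝ (Fin n)} {T : ℝ}
    (h : IsLUB {t | fibreMem Ω t p} T) : (T : EReal) = upperHeight Ω p := by
  refine le_antisymm ?_ (iSup₂_le fun t ht => EReal.coe_le_coe_iff.2 (h.1 ht))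
  refine EReal.le_of_forall_lt_iff_le.1 fun z hz => ?_
  by_contra! hlt
  have hz' : z < T := EReal.coe_lt_coe_iff.1 hlt
  obtain ⟨t, ht, hzt⟩ := (lt_isLUB_iff h).1 hz'
  exact hz.not_ge
    ((EReal.coe_le_coe_iff.2 hzt.le).trans (le_iSup₂ (f := fun (t : ℝ) (_ : WithLp.toLp 2 (t, p) ∈ Ω)
      => (t : EReal)) t ht))

theorem lowerHeight_eq_of_isGLB {Ω : Set (Minkowski n)} {p : EuclideanSpace ℝ (Fin n)} {T : ℝ}
    (h : IsGLB {t | fibreMem Ω t p} T) : (T : EReal) = lowerHeight Ω p := by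
  refine le_antisymm (le_iInf₂ fun t ht => EReal.coe_le_coe_iff.2 (h.1 ht)) ?_
  refine EReal.ge_of_forall_gt_iff_ge.1 fun z hz => ?_
  by_contra! hlt
  have hz' : T < z := EReal.coe_lt_coe_iff.1 hlt
  obtain ⟨t, ht, hzt⟩ := (isGLB_lt_iff h).1 hz'
  exact hz.not_ge ((iInf₂_le (f := fun (t : ℝ) (_ : WithLp.toLp 2 (t, p) ∈ Ω)
      => (t : EReal)) t ht).trans (EReal.coe_le_coe_iff.2 hzt.le))

/-- Otherwise the straight segment from `x` to `y` would be future causal for `b_ε`. -/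
theorem IsStablyAcausal.fst_sub_le {ε : ℝ} (hε : 0 < ε) {C : Set (Minkowski n)}
    (hC : IsStablyAcausal ε C) {x y : Minkowski n} (hx : x ∈ C) (hy : y ∈ C) :
    y.fst - x.fst ≤ (1 + ε)⁻¹ * ‖y.snd - x.snd‖ := by
  by_contra! h
  have h0 : x.fst < y.fst := by
    have : 0 ≤ (1 + ε)⁻¹ * ‖y.snd - x.snd‖ := by positivity
    linarith
  refine hC x hx y hy (fun he => h0.ne (by rw [he])) (causallyPrecedes_of_le hε.le h0 ?_)
  rw [inv_mul_lt_iff₀ (by positivity)] at h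
  exact h.le

theorem hasLipschitzSup_of_future {Ω : Set (Minkowski n)} {ε : ℝ} (hε : 0 < ε)
    (hfut : IsStablyAcausal ε (futureCausalBoundary Ω)) :
    HasLipschitzSup (1 + ε)⁻¹ (fibreMem Ω) := fun p q T T' hT hT' =>
  hfut.fst_sub_le hε (x := WithLp.toLp 2 (T, p)) (y := WithLp.toLp 2 (T', q))
    ⟨hT.nonempty, upperHeight_eq_of_isLUB hT⟩ ⟨hT'.nonempty, upperHeight_eq_of_isLUB hT'⟩

theorem hasLipschitzSup_of_past {Ω : Set (Minkowski n)} {ε : ℝ} (hε : 0 < ε)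
    (hpast : IsStablyAcausal ε (pastCausalBoundary Ω)) :
    HasLipschitzSup (1 + ε)⁻¹ fun t p => fibreMem Ω (-t) p := by
  intro p q T T' hT hT'
  have neg : ∀ {p T}, IsLUB {t | fibreMem Ω (-t) p} T → IsGLB {t | fibreMem Ω t p} (-T) := by
    intro p T h
    have := isGLB_neg.2 ((neg_neg T).symm ▸ h)
    rwa [show -{t | fibreMem Ω (-t) p} = {t | fibreMem Ω t p} by ext; simp] at this
  have := hpast.fst_sub_le hε (x := WithLp.toLp 2 (-T', q)) (y := WithLp.toLp 2 (-T, p))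
    ⟨(neg hT').nonempty, lowerHeight_eq_of_isGLB (neg hT')⟩
    ⟨(neg hT).nonempty, lowerHeight_eq_of_isGLB (neg hT)⟩
  rw [norm_sub_rev q p]
  simpa [sub_eq_neg_add, add_comm] using this

theorem isOpen_shadow {Ω : Set (Minkowski n)} (hΩ : IsOpen Ω) :
    IsOpen {p | ∃ t, fibreMem Ω t p} := by
  have : {p | ∃ t, fibreMem Ω t p} = ⋃ t : ℝ, {p | fibreMem Ω t p} := by ext; simp
  rw [this]
  refine isOpen_iUnion fun t => hΩ.preimage ?_
  fun_prop

/-! ### Distance to the boundary and lightlike segments. -/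

theorem IsProperDomain.frontier_nonempty {Ω : Set (Minkowski n)} (hΩ : IsProperDomain Ω) :
    (frontier Ω).Nonempty :=
  nonempty_frontier_iff.2 ⟨hΩ.isConnected.nonempty, hΩ.ne_univ⟩

theorem IsProperDomain.infDist_pos {Ω : Set (Minkowski n)} (hΩ : IsProperDomain Ω) {z : Minkowski n}
    (hz : z ∈ Ω) : 0 < Metric.infDist z (frontier Ω) := by
  refine (isClosed_frontier.notMem_iff_infDist_pos hΩ.frontier_nonempty).1 fun h => ?_
  rw [hΩ.isOpen.frontier_eq] at h
  exact h.2 hz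

theorem ball_infDist_frontier_subset {Ω : Set (Minkowski n)} (hΩ : IsOpen Ω) {z : Minkowski n}
    (hz : z ∈ Ω) : Metric.ball z (Metric.infDist z (frontier Ω)) ⊆ Ω := by
  intro w hw
  have hr : 0 < Metric.infDist z (frontier Ω) := dist_nonneg.trans_lt hw
  refine Metric.isPreconnected_ball.subset_of_closure_inter_subset hΩ
    ⟨z, Metric.mem_ball_self hr, hz⟩ ?_ hw
  rintro r ⟨hrc, hrb⟩
  by_contra hn
  have : r ∈ frontier Ω := by rw [hΩ.frontier_eq]; exact ⟨hrc, hn⟩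
  have := Metric.infDist_le_dist_of_mem (x := z) this
  rw [Metric.mem_ball, dist_comm] at hrb
  linarith

theorem IsProperDomain.le_infDist {Ω : Set (Minkowski n)} (hΩ : IsProperDomain Ω) {z : Minkowski n}
    {r : ℝ} (h : Metric.ball z r ⊆ Ω) : r ≤ Metric.infDist z (frontier Ω) := by
  refine (Metric.le_infDist hΩ.frontier_nonempty).2 fun w hw => ?_
  by_contra! hlt
  rw [hΩ.isOpen.frontier_eq] at hw
  exact hw.2 (h (by rwa [Metric.mem_ball, dist_comm]))

/-- The constant of the lower bound. -/
def lowerConst (ε : ℝ) : ℝ := ε / Real.sqrt ((2 + ε) ^ 2 + ε ^ 2)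

theorem lowerConst_pos {ε : ℝ} (hε : 0 < ε) : 0 < lowerConst ε := by
  unfold lowerConst; positivity

theorem IsLightlike.norm_snd {v : Minkowski n} (hv : IsLightlike v) : ‖v.snd‖ = |v.fst| := by
  have := hv.2
  rw [form_self, add_zero, one_mul, sub_eq_zero] at this
  rw [← abs_norm]
  exact (sq_eq_sq_iff_abs_eq_abs _ _).1 this

theorem IsLightlike.norm_eq {v : Minkowski n} (hv : IsLightlike v) : ‖v‖ = √2 * |v.fst| := by
  have h := norm_sq_eq v
  rw [hv.norm_snd, sq_abs] at h
  rw [← abs_norm, ← Real.sqrt_sq_eq_abs, h, ← two_mul, Real.sqrt_mul zero_le_two,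
    Real.sqrt_sq_eq_abs]

/-- If a lightlike segment centred at `z` lies in `Ω`, then `z` is far from the boundary. -/
theorem lowerConst_mul_norm_le_infDist {Ω : Set (Minkowski n)} (hΩ : IsProperDomain Ω)
    (hcc : IsCausallyConvex Ω) {ε : ℝ} (hε : 0 < ε)
    (hfut : IsStablyAcausal ε (futureCausalBoundary Ω))
    (hpast : IsStablyAcausal ε (pastCausalBoundary Ω)) {z v : Minkowski n}
    (hv : IsLightlike v) (hz : z ∈ Ω) (h₁ : z + v ∈ Ω) (h₂ : z - v ∈ Ω) :
    lowerConst ε * ‖v‖ ≤ Metric.infDist z (frontier Ω) := by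
  -- Replacing `v` by `-v` exchanges the two endpoints.
  wlog hpos : 0 ≤ v.fst generalizing v with H
  · have hv' : IsLightlike (-v) := by
      refine ⟨neg_ne_zero.2 hv.1, ?_⟩
      have := hv.2
      rw [form_self] at this ⊢
      simpa using this
    simpa using H hv' (by simpa [sub_eq_add_neg] using h₂) (by simpa using h₁)
      (by simp; linarith)
  refine hΩ.le_infDist fun w hw => ?_
  have hnv := hv.norm_eq
  have hns := hv.norm_snd
  rw [abs_of_nonneg hpos] at hnv hns
  set l := (1 + ε)⁻¹ with hl
  have hl0 : 0 < l := by positivity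
  refine (isDiamondConvex_fibreMem hcc).doubleCone_mem (t := z.fst) (p := z.snd) (S := v.fst)
    (q := v.snd) (t' := w.fst) (p' := w.snd) hl0 (hasLipschitzSup_of_future hε hfut)
    (hasLipschitzSup_of_past hε hpast) (isOpen_shadow hΩ.isOpen) hz hns.le h₁ h₂ ?_
  rw [mem_ball_iff_norm, hnv, lowerConst] at hw
  have hsq := norm_sq_eq (w - z)
  rw [WithLp.sub_fst, WithLp.sub_snd] at hsq
  set D := ‖w - z‖
  set α := w.fst - z.fst
  set β := ‖w.snd - z.snd‖
  have hβ : 0 ≤ β := norm_nonneg _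
  have hD : 0 ≤ D := norm_nonneg _
  set R := √((2 + ε) ^ 2 + ε ^ 2) with hR
  have hR2 : R ^ 2 = (2 + ε) ^ 2 + ε ^ 2 := Real.sq_sqrt (by positivity)
  have hR0 : 0 < R := by positivity
  have hs2 : √2 ^ 2 = 2 := Real.sq_sqrt (by norm_num)
  have hDR : D * R < ε * √2 * v.fst := by
    rw [div_mul_eq_mul_div, lt_div_iff₀ hR0] at hw
    linarith
  have hlε : l * (1 + ε) = 1 := inv_mul_cancel₀ (by positivity)
  -- This is the double cone condition multiplied by `1 + ε`. As `R² = 2((1+ε)² + 1)` and `‖v‖² = 2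
  -- v.fst²`, it follows from Cauchy–Schwarz for `(1+ε, 1)` and `(|α|, β)`, whose defect is the
  -- square given to `nlinarith`.
  have e1 : (1 + ε) * |α| + β < ε * v.fst := by
    have hvp : 0 ≤ ε * v.fst := by positivity
    refine lt_of_pow_lt_pow_left₀ 2 hvp ?_
    have h2 : (D * R) ^ 2 < (ε * √2 * v.fst) ^ 2 := pow_lt_pow_left₀ hDR (by positivity) (by norm_num)
    have h3 : (ε * √2 * v.fst) ^ 2 = 2 * (ε * v.fst) ^ 2 := by
      rw [mul_pow, mul_pow, hs2]; ring
    rw [h3, mul_pow, hR2, hsq] at h2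
    have h4 : |α| ^ 2 = α ^ 2 := sq_abs α
    nlinarith [sq_nonneg ((1 + ε) * β - |α|)]
  have e2 : |α| + l * β = l * ((1 + ε) * |α| + β) := by linear_combination (-|α|) * hlε
  have e3 : (1 - l) * v.fst = l * (ε * v.fst) := by linear_combination (-v.fst) * hlε
  rw [e2, e3]
  exact mul_lt_mul_of_pos_left e1 hl0

/-! ### Projective parameters are homographies. -/

section Projective

variable {J : Set ℝ} {u : ℝ → ℝ}

theorem hasDerivAt_iteratedDeriv (hJ : IsOpen J) (hu : ContDiffOn ℝ ∞ u J) (k : ℕ) {t : ℝ}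
    (ht : t ∈ J) : HasDerivAt (iteratedDeriv k u) (iteratedDeriv (k + 1) u t) t := by
  have h : ∀ k, ContDiffOn ℝ ∞ (iteratedDeriv k u) J := fun k => by
    induction k with
    | zero => simpa using hu
    | succ k ih =>
      rw [iteratedDeriv_succ]
      exact ih.deriv_of_isOpen hJ (by simp)
  rw [iteratedDeriv_succ]
  exact (((h k).contDiffAt (hJ.mem_nhds ht)).differentiableAt (by simp)).hasDerivAt

/-- Fix `y` and let the base point vary. The defect `Φ` of the identity satisfies `Φ' = (u₂ / (2
u₁)) Φ`, so `Φ² / u₁` is constant on `J`; it vanishes at `y`. -/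
theorem homography_of_ode {u₁ u₂ u₃ : ℝ → ℝ} (hJ : IsOpen J) (hJc : J.OrdConnected)
    (d₀ : ∀ s ∈ J, HasDerivAt u (u₁ s) s) (d₁ : ∀ s ∈ J, HasDerivAt u₁ (u₂ s) s)
    (d₂ : ∀ s ∈ J, HasDerivAt u₂ (u₃ s) s) (h₀ : ∀ t ∈ J, u₁ t ≠ 0)
    (h₃ : ∀ s ∈ J, u₃ s = 3 / 2 * u₂ s ^ 2 / u₁ s) {t y : ℝ} (ht : t ∈ J) (hy : y ∈ J) :
    (u y - u t) * (1 - (y - t) * (u₂ t / u₁ t / 2)) = (y - t) * u₁ t := by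
  set Φ : ℝ → ℝ := fun t => (u y - u t) * (1 - (y - t) * (u₂ t / u₁ t / 2)) - (y - t) * u₁ t with hΦ
  have hd : ∀ s ∈ J, HasDerivAt (fun s => Φ s ^ 2 / u₁ s) 0 s := fun s hs => by
    have hn := h₀ s hs
    have hid : HasDerivAt (fun s => y - s) (-1) s := (hasDerivAt_id s).const_sub y
    have hP : HasDerivAt (fun s => u₂ s / u₁ s / 2) _ s := ((d₂ s hs).div (d₁ s hs) hn).div_const 2
    have hΦd : HasDerivAt Φ (u₂ s / u₁ s / 2 * Φ s) s := by
      refine ((((d₀ s hs).const_sub (u y)).mul ((hid.mul hP).const_sub 1)).sub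
        (hid.mul (d₁ s hs))).congr_deriv ?_
      simp only [hΦ, h₃ s hs, Pi.mul_apply]
      field_simp
      ring
    refine ((hΦd.pow 2).div (d₁ s hs) hn).congr_deriv ?_
    simp only [Pi.pow_apply]
    field_simp
    ring
  have hconst : (fun s => Φ s ^ 2 / u₁ s) t = (fun s => Φ s ^ 2 / u₁ s) y :=
    hJ.is_const_of_deriv_eq_zero hJc.isPreconnected
      (fun s hs => (hd s hs).differentiableAt.differentiableWithinAt)
      (fun s hs => (hd s hs).deriv) ht hy
  have hy0 : Φ y = 0 := by simp [hΦ]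
  simp only [hy0] at hconst
  have : Φ t = 0 := by
    have hn := h₀ t ht
    simpa [hn] using hconst
  exact sub_eq_zero.1 this

/-- A function with vanishing Schwarzian derivative is a homography. -/
theorem homography_of_schwarzian_eq_zero (hJ : IsOpen J) (hJc : J.OrdConnected)
    (hu : ContDiffOn ℝ ∞ u J) (h₀ : ∀ t ∈ J, deriv u t ≠ 0) (hS : ∀ t ∈ J, schwarzian u t = 0)
    {t y : ℝ} (ht : t ∈ J) (hy : y ∈ J) :
    (u y - u t) * (1 - (y - t) * (iteratedDeriv 2 u t / deriv u t / 2)) = (y - t) * deriv u t := by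
  refine homography_of_ode (u₃ := iteratedDeriv 3 u) hJ hJc (fun s hs => ?_) (fun s hs => ?_)
    (fun s hs => hasDerivAt_iteratedDeriv hJ hu 2 hs) h₀ (fun s hs => ?_) ht hy
  · have := hasDerivAt_iteratedDeriv hJ hu 0 hs
    rwa [iteratedDeriv_zero, zero_add, iteratedDeriv_one] at this
  · have := hasDerivAt_iteratedDeriv hJ hu 1 hs
    rwa [iteratedDeriv_one] at this
  · have := hS s hs
    have hn := h₀ s hs
    rw [schwarzian, sub_eq_zero, div_eq_iff hn] at this
    rw [this]
    field_simp

theorem strictMonoOn_or_strictAntiOn (hJ : IsOpen J) (hJc : J.OrdConnected)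
    (hu : ContDiffOn ℝ ∞ u J) (h₀ : ∀ t ∈ J, deriv u t ≠ 0) :
    StrictMonoOn u J ∨ StrictAntiOn u J := by
  have hd : ∀ t ∈ J, HasDerivWithinAt u (deriv u t) J t := fun t ht =>
    ((hu.contDiffAt (hJ.mem_nhds ht)).differentiableAt (by simp)).hasDerivAt.hasDerivWithinAt
  rcases hasDerivWithinAt_forall_lt_or_forall_gt_of_forall_ne hJc.convex hd h₀ with h | h
  · exact Or.inr (strictAntiOn_of_deriv_neg hJc.convex hu.continuousOn
      fun t ht => h t (interior_subset ht))
  · exact Or.inl (strictMonoOn_of_deriv_pos hJc.convex hu.continuousOn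
      fun t ht => h t (interior_subset ht))

/-- The domain of a projective parameter onto `(-1, 1)` contains the symmetric interval around `t`
whose radius is the inverse of the density of the distance of `(-1, 1)`. -/
theorem add_mem_and_sub_mem (hJ : IsOpen J) (hJc : J.OrdConnected)
    (hu : ContDiffOn ℝ ∞ u J) (h₀ : ∀ t ∈ J, deriv u t ≠ 0) (hS : ∀ t ∈ J, schwarzian u t = 0)
    (him : u '' J = Ioo (-1) 1) {t : ℝ} (ht : t ∈ J) {r : ℝ} (hr0 : 0 < r)
    (hr : r < (1 - u t ^ 2) / (2 * |deriv u t|)) : t + r ∈ J ∧ t - r ∈ J := by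
  have hut : u t ∈ Ioo (-1 : ℝ) 1 := him ▸ mem_image_of_mem u ht
  set a := u t with ha
  set d := deriv u t with hd
  have hd0 : 0 < |d| := abs_pos.2 (h₀ t ht)
  have h1 : 0 < 1 - a := by linarith [hut.2]
  have h2 : 0 < 1 + a := by linarith [hut.1]
  set m := (1 - a ^ 2) / (2 * |d|) with hm
  have hm0 : 0 < m := hr0.trans hr
  set κ := r / m with hκ
  have hκ0 : 0 < κ := by positivity
  have hκ1 : κ < 1 := (div_lt_one hm0).2 hr
  -- The values of `u` at `y₁` and `y₂` lie at the fraction `κ = r / m` of the way from `a` to `1`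
  -- and to `-1`. Staying short of the ends avoids discussing the possibly infinite endpoints of
  -- `J`.
  obtain ⟨y₁, hy₁, e₁⟩ : a + κ * (1 - a) ∈ u '' J := by
    rw [him]; constructor <;> nlinarith
  obtain ⟨y₂, hy₂, e₂⟩ : a - κ * (1 + a) ∈ u '' J := by
    rw [him]; constructor <;> nlinarith
  have k₁ := homography_of_schwarzian_eq_zero hJ hJc hu h₀ hS ht hy₁
  have k₂ := homography_of_schwarzian_eq_zero hJ hJc hu h₀ hS ht hy₂
  rw [e₁, ← ha, ← hd, add_sub_cancel_left] at k₁
  rw [e₂, ← ha, ← hd, sub_sub_cancel_left] at k₂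
  set Q := iteratedDeriv 2 u t / d / 2
  set η₁ := κ * (1 - a) with hη₁
  set η₂ := κ * (1 + a) with hη₂
  have p₁ : 0 < η₁ := by positivity
  have p₂ : 0 < η₂ := by positivity
  have n₁ : y₁ - t ≠ 0 := fun h => by rw [sub_eq_zero.1 h] at e₁; linarith
  have n₂ : y₂ - t ≠ 0 := fun h => by rw [sub_eq_zero.1 h] at e₂; linarith
  have i₁ : (y₁ - t)⁻¹ = d / η₁ + Q := by
    field_simp
    linear_combination k₁
  have i₂ : (y₂ - t)⁻¹ = -d / η₂ + Q := by
    field_simp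
    linear_combination -k₂
  have hsum : 1 / η₁ + 1 / η₂ = 1 / (|d| * r) := by
    have hrm : r = κ * m := by rw [hκ]; field_simp
    have h3 : 1 - a ^ 2 = (1 - a) * (1 + a) := by ring
    rw [hrm, hm, hη₁, hη₂, h3]
    field_simp
    ring
  -- The second-order term `Q` cancels and the difference is `±1/r`. Since `y₁` and `y₂` lie on
  -- opposite sides of `t`, each reciprocal is at most `1/r` in absolute value, so both points are
  -- at distance at least `r` from `t`.
  have hdiff : (y₁ - t)⁻¹ - (y₂ - t)⁻¹ = d * (1 / (|d| * r)) := by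
    rw [i₁, i₂, ← hsum]; ring
  have fin : ∀ {σ τ : ℝ}, 0 < σ → τ < 0 → σ⁻¹ - τ⁻¹ = 1 / r → r ≤ σ ∧ τ ≤ -r := by
    intro σ τ hσ hτ h
    have g₁ : 0 < σ⁻¹ := inv_pos.2 hσ
    have g₂ : 0 < (-τ)⁻¹ := inv_pos.2 (by linarith)
    have g₃ : σ⁻¹ + (-τ)⁻¹ = r⁻¹ := by rw [inv_neg, ← one_div r, ← h]; ring
    refine ⟨(inv_le_inv₀ hσ hr0).1 (by linarith), ?_⟩
    have := (inv_le_inv₀ (by linarith : 0 < -τ) hr0).1 (by linarith)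
    linarith
  have mem : ∀ {σ τ : ℝ}, σ ∈ J → τ ∈ J → r ≤ σ - t → τ - t ≤ -r → t + r ∈ J ∧ t - r ∈ J :=
    fun hσ hτ h h' => ⟨hJc.out hτ hσ ⟨by linarith, by linarith⟩,
      hJc.out hτ hσ ⟨by linarith, by linarith⟩⟩
  have hdn : d ≠ 0 := h₀ t ht
  rcases strictMonoOn_or_strictAntiOn hJ hJc hu h₀ with hmono | hanti
  · have q₁ : t < y₁ := (hmono.lt_iff_lt ht hy₁).1 (by rw [e₁]; linarith)
    have q₂ : y₂ < t := (hmono.lt_iff_lt hy₂ ht).1 (by rw [e₂]; linarith)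
    have hg₁ : 0 < (y₁ - t)⁻¹ := inv_pos.2 (by linarith)
    have hg₂ : (y₂ - t)⁻¹ < 0 := inv_lt_zero.2 (by linarith)
    have hdp : 0 < d := by
      have : 0 < 1 / (|d| * r) := by positivity
      by_contra! hneg
      have := mul_nonpos_of_nonpos_of_nonneg hneg this.le
      linarith
    rw [abs_of_pos hdp] at hdiff
    obtain ⟨g, g'⟩ := fin (σ := y₁ - t) (τ := y₂ - t) (by linarith) (by linarith)
      (by rw [hdiff]; field_simp)
    exact mem hy₁ hy₂ g g'
  · have q₁ : y₁ < t := (hanti.lt_iff_gt ht hy₁).1 (by rw [e₁]; linarith)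
    have q₂ : t < y₂ := (hanti.lt_iff_gt hy₂ ht).1 (by rw [e₂]; linarith)
    have hg₁ : (y₁ - t)⁻¹ < 0 := inv_lt_zero.2 (by linarith)
    have hg₂ : 0 < (y₂ - t)⁻¹ := inv_pos.2 (by linarith)
    have hdp : d < 0 := by
      have : 0 < 1 / (|d| * r) := by positivity
      by_contra! hneg
      have := mul_nonneg hneg this.le
      linarith
    rw [abs_of_neg hdp] at hdiff
    obtain ⟨g, g'⟩ := fin (σ := y₂ - t) (τ := y₁ - t) (by linarith) (by linarith)
      (by rw [← neg_sub, hdiff]; field_simp)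
    exact mem hy₂ hy₁ g g'

end Projective

/-! ### Comparison of the two lengths along one lightlike geodesic. -/

theorem intervalDist_eq {s t : ℝ} (hs : s ∈ Ioo (-1 : ℝ) 1) (ht : t ∈ Ioo (-1 : ℝ) 1) :
    intervalDist s t =
      |(Real.log (1 + t) - Real.log (1 - t)) - (Real.log (1 + s) - Real.log (1 - s))| := by
  have h1 : 0 < 1 + s := by linarith [hs.1]
  have h2 : 0 < 1 - s := by linarith [hs.2]
  have h3 : 0 < 1 + t := by linarith [ht.1]
  have h4 : 0 < 1 - t := by linarith [ht.2]
  have : (s - 1) * (t + 1) / ((s + 1) * (t - 1)) = ((1 + t) / (1 - t)) / ((1 + s) / (1 - s)) := by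
    have h5 : t - 1 ≠ 0 := by linarith
    have h6 : s + 1 ≠ 0 := by linarith
    field_simp
    ring
  rw [intervalDist, this, Real.log_div (by positivity) (by positivity),
    Real.log_div h3.ne' h4.ne', Real.log_div h1.ne' h2.ne']

open MeasureTheory in
/-- The length of a monotone path in `(-1, 1)`, for the metric `2 |dx| / (1 - x²)`. -/
theorem lintegral_density_le_intervalDist {w w' : ℝ → ℝ}
    (hw : ∀ θ ∈ Icc (0 : ℝ) 1, HasDerivAt w (w' θ) θ) (hc : ContinuousOn w' (Icc 0 1))
    (hmem : ∀ θ ∈ Icc (0 : ℝ) 1, w θ ∈ Ioo (-1 : ℝ) 1)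
    (hsign : (∀ θ ∈ Icc (0 : ℝ) 1, w' θ < 0) ∨ ∀ θ ∈ Icc (0 : ℝ) 1, 0 < w' θ) :
    ∫⁻ θ in Icc (0 : ℝ) 1, ENNReal.ofReal (2 * |w' θ| / (1 - w θ ^ 2)) ≤
      ENNReal.ofReal (intervalDist (w 0) (w 1)) := by
  have hcw : ContinuousOn w (Icc 0 1) := fun θ hθ => (hw θ hθ).continuousAt.continuousWithinAt
  have hpos : ∀ θ ∈ Icc (0 : ℝ) 1, 0 < 1 - w θ ^ 2 := fun θ hθ => by
    obtain ⟨h1, h2⟩ := hmem θ hθ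
    nlinarith
  have hcont : ContinuousOn (fun θ => 2 * w' θ / (1 - w θ ^ 2)) (Icc 0 1) :=
    (continuousOn_const.mul hc).div (continuousOn_const.sub (hcw.pow 2)) fun θ hθ => (hpos θ hθ).ne'
  have hint : ∫ θ in (0 : ℝ)..1, 2 * w' θ / (1 - w θ ^ 2) =
      (Real.log (1 + w 1) - Real.log (1 - w 1)) - (Real.log (1 + w 0) - Real.log (1 - w 0)) := by
    refine intervalIntegral.integral_eq_sub_of_hasDerivAt
      (f := fun θ => Real.log (1 + w θ) - Real.log (1 - w θ)) (fun θ hθ => ?_)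
      (hcont.mono (by rw [uIcc_of_le zero_le_one])).intervalIntegrable
    rw [uIcc_of_le zero_le_one] at hθ
    obtain ⟨h1, h2⟩ := hmem θ hθ
    have h1' : 1 + w θ ≠ 0 := by linarith
    have h2' : 1 - w θ ≠ 0 := by linarith
    refine ((((hw θ hθ).const_add 1).log h1').sub (((hw θ hθ).const_sub 1).log h2')).congr_deriv ?_
    have : 1 - w θ ^ 2 = (1 - w θ) * (1 + w θ) := by ring
    rw [this]
    field_simp
    ring
  have habs : ContinuousOn (fun θ => 2 * |w' θ| / (1 - w θ ^ 2)) (Icc 0 1) :=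
    (continuousOn_const.mul hc.abs).div (continuousOn_const.sub (hcw.pow 2))
      fun θ hθ => (hpos θ hθ).ne'
  rw [← ofReal_integral_eq_lintegral_ofReal habs.integrableOn_Icc
    (ae_restrict_of_forall_mem measurableSet_Icc fun θ hθ =>
      div_nonneg (by positivity) (hpos θ hθ).le), integral_Icc_eq_integral_Ioc,
    ← intervalIntegral.integral_of_le zero_le_one]
  refine ENNReal.ofReal_le_ofReal ?_
  rw [intervalDist_eq (hmem 0 (by simp)) (hmem 1 (by simp)), ← hint]
  rcases hsign with h | h
  · refine le_trans (le_of_eq ?_) (neg_le_abs _)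
    rw [← intervalIntegral.integral_neg]
    refine intervalIntegral.integral_congr fun θ hθ => ?_
    rw [uIcc_of_le zero_le_one] at hθ
    simp only [abs_of_neg (h θ hθ)]
    ring
  · refine le_trans (le_of_eq ?_) (le_abs_self _)
    refine intervalIntegral.integral_congr fun θ hθ => ?_
    rw [uIcc_of_le zero_le_one] at hθ
    simp only [abs_of_pos (h θ hθ)]

/-- The quasi-hyperbolic length of the straight segment from `x` to `y`. -/
def segmentLength (Ω : Set (Minkowski n)) (x y : Minkowski n) : ℝ≥0∞ :=
  ∫⁻ θ in Icc (0 : ℝ) 1,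
    ENNReal.ofReal (‖y - x‖ / Metric.infDist (x + θ • (y - x)) (frontier Ω))

theorem IsPPL.segment {Ω : Set (Minkowski n)} (hΩ : IsProperDomain Ω)
    (hcc : IsCausallyConvex Ω) {ε : ℝ} (hε : 0 < ε)
    (hfut : IsStablyAcausal ε (futureCausalBoundary Ω))
    (hpast : IsStablyAcausal ε (pastCausalBoundary Ω)) {γ : ℝ → Minkowski n} (hγ : IsPPL Ω γ)
    {s t : ℝ} (hs : s ∈ Ioo (-1 : ℝ) 1) (ht : t ∈ Ioo (-1 : ℝ) 1) :
    (∀ θ ∈ Icc (0 : ℝ) 1, γ s + θ • (γ t - γ s) ∈ Ω) ∧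
      ENNReal.ofReal (lowerConst ε) * segmentLength Ω (γ s) (γ t) ≤
        ENNReal.ofReal (intervalDist s t) := by
  obtain ⟨a, v, J, u, hv, hJ, hJc, hmem, hu, h₀, hS, him, hγu⟩ := hγ
  obtain ⟨t₁, ht₁, rfl⟩ : s ∈ u '' J := him ▸ hs
  obtain ⟨t₂, ht₂, rfl⟩ : t ∈ u '' J := him ▸ ht
  rw [hγu _ ht₁, hγu _ ht₂]
  set τ : ℝ → ℝ := fun θ => t₁ + θ * (t₂ - t₁) with hτ
  have hseg : ∀ θ : ℝ, a + t₁ • v + θ • (a + t₂ • v - (a + t₁ • v)) = a + τ θ • v := fun θ => by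
    simp only [hτ]; module
  have hτJ : ∀ θ ∈ Icc (0 : ℝ) 1, τ θ ∈ J := fun θ hθ => by
    have := hJc.convex.add_smul_sub_mem ht₁ ht₂ hθ
    simpa [hτ] using this
  refine ⟨fun θ hθ => by rw [hseg]; exact hmem _ (hτJ θ hθ), ?_⟩
  have hvv : a + t₂ • v - (a + t₁ • v) = (t₂ - t₁) • v := by module
  rcases eq_or_ne t₁ t₂ with rfl | hne
  · simp [segmentLength]
  have hd0 : t₂ - t₁ ≠ 0 := sub_ne_zero.2 hne.symm
  have hw : ∀ θ ∈ Icc (0 : ℝ) 1,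
      HasDerivAt (fun θ => u (τ θ)) (deriv u (τ θ) * (t₂ - t₁)) θ := fun θ hθ => by
    have h1 : HasDerivAt τ (t₂ - t₁) θ := by
      simpa only [one_mul] using ((hasDerivAt_id' θ).mul_const (t₂ - t₁)).const_add t₁
    have h2 := ((hu.contDiffAt (hJ.mem_nhds (hτJ θ hθ))).differentiableAt (by simp)).hasDerivAt
    exact h2.comp θ h1
  have hcont : ContinuousOn (fun θ => deriv u (τ θ) * (t₂ - t₁)) (Icc 0 1) := by
    refine ContinuousOn.mul ?_ continuousOn_const
    refine ContinuousOn.comp (g := deriv u) (t := J) (fun y hy => ?_) (by fun_prop) hτJ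
    have := hasDerivAt_iteratedDeriv hJ hu 1 hy
    rw [iteratedDeriv_one] at this
    exact this.continuousAt.continuousWithinAt
  have key := lintegral_density_le_intervalDist hw hcont
    (fun θ hθ => him ▸ mem_image_of_mem u (hτJ θ hθ))
    (hasDerivWithinAt_forall_lt_or_forall_gt_of_forall_ne (convex_Icc 0 1)
      (fun θ hθ => (hw θ hθ).hasDerivWithinAt) fun θ hθ => mul_ne_zero (h₀ _ (hτJ θ hθ)) hd0)
  have e0 : τ 0 = t₁ := by simp [hτ]
  have e1 : τ 1 = t₂ := by simp [hτ]
  simp only [e0, e1] at key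
  refine le_trans ?_ key
  rw [segmentLength, ← MeasureTheory.lintegral_const_mul' _ _ ENNReal.ofReal_ne_top]
  refine MeasureTheory.setLIntegral_mono' measurableSet_Icc fun θ hθ => ?_
  rw [← ENNReal.ofReal_mul (lowerConst_pos hε).le, hseg, hvv, norm_smul, Real.norm_eq_abs, abs_mul]
  refine ENNReal.ofReal_le_ofReal ?_
  have hz := hmem _ (hτJ θ hθ)
  have hD := hΩ.infDist_pos hz
  set D := Metric.infDist (a + τ θ • v) (frontier Ω) with hDdef
  set m := (1 - u (τ θ) ^ 2) / (2 * |deriv u (τ θ)|) with hm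
  have hdu : 0 < |deriv u (τ θ)| := abs_pos.2 (h₀ _ (hτJ θ hθ))
  have hsq : 0 < 1 - u (τ θ) ^ 2 := by
    obtain ⟨h1, h2⟩ : u (τ θ) ∈ Ioo (-1 : ℝ) 1 := him ▸ mem_image_of_mem u (hτJ θ hθ)
    nlinarith
  have hm0 : 0 < m := by positivity
  have hvn : 0 < ‖v‖ := norm_pos_iff.2 hv.1
  have hc0 := lowerConst_pos hε
  -- The points at parameter `τ θ ± r` are known to lie in `Ω` only for `r < m`; the bound at `m` is
  -- reached by letting `r` tend to `m`.
  have hmD : lowerConst ε * ‖v‖ * m ≤ D := by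
    have : ∀ r, r < m → 0 < r → lowerConst ε * ‖v‖ * r ≤ D := fun r hr hr0 => by
      obtain ⟨m₁, m₂⟩ := add_mem_and_sub_mem hJ hJc hu h₀ hS him (hτJ θ hθ) hr0 hr
      have hrv : IsLightlike (r • v) := by
        refine ⟨smul_ne_zero hr0.ne' hv.1, ?_⟩
        have := hv.2
        rw [form_self] at this ⊢
        simp only [WithLp.smul_snd, WithLp.smul_fst, norm_smul, smul_eq_mul, Real.norm_eq_abs,
          mul_pow, sq_abs]
        linear_combination r ^ 2 * this
      have := lowerConst_mul_norm_le_infDist hΩ hcc hε hfut hpast hrv hz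
        (by convert hmem _ m₁ using 1; module) (by convert hmem _ m₂ using 1; module)
      rw [norm_smul, Real.norm_eq_abs, abs_of_pos hr0] at this
      linarith
    by_contra! hlt
    obtain ⟨r, hr1, hr2⟩ := exists_between (show D / (lowerConst ε * ‖v‖) < m by
      rw [div_lt_iff₀ (by positivity)]; linarith)
    have h3 := this r hr2 (lt_of_le_of_lt (by positivity) hr1)
    rw [div_lt_iff₀ (by positivity)] at hr1
    linarith
  rw [← mul_div_assoc, div_le_div_iff₀ hD hsq]
  have : 1 - u (τ θ) ^ 2 = m * (2 * |deriv u (τ θ)|) := by rw [hm]; field_simp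
  rw [this]
  have := mul_le_mul_of_nonneg_left hmD
    (show 0 ≤ |t₂ - t₁| * (2 * |deriv u (τ θ)|) by positivity)
  linarith

/-! ### Concatenation of curves, finiteness of `k_Ω` and the lower bound. -/

theorem IsSubdivision.le_of_le {a b : ℝ} {m : ℕ} {t : ℕ → ℝ} (h : IsSubdivision a b m t) {i j : ℕ}
    (hij : i ≤ j) (hj : j ≤ m) : t i ≤ t j := by
  induction j, hij using Nat.le_induction with
  | base => rfl
  | succ k _ ih => exact (ih (by omega)).trans (h.2.2 k (by omega)).le

theorem IsSubdivision.le {a b : ℝ} {m : ℕ} {t : ℕ → ℝ} (h : IsSubdivision a b m t) : a ≤ b := by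
  have := h.le_of_le (Nat.zero_le m) le_rfl
  rwa [h.1, h.2.1] at this

theorem IsPiecewiseSmooth.le {γ : ℝ → Minkowski n} {a b : ℝ} (h : IsPiecewiseSmooth γ a b) :
    a ≤ b := by
  obtain ⟨m, t, ht, -⟩ := h
  exact ht.le

theorem IsPiecewiseSmooth.appendLine {γ : ℝ → Minkowski n} {a b : ℝ} (h : IsPiecewiseSmooth γ a b)
    (v : Minkowski n) : IsPiecewiseSmooth (appendLine γ b v) a (b + 1) := by
  obtain ⟨m, t, ht, hs⟩ := h
  have hlt : ∀ {i}, i ≤ m → (fun i => if i ≤ m then t i else b + 1) i = t i := fun h => if_pos h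
  have hlast : (fun i => if i ≤ m then t i else b + 1) (m + 1) = b + 1 := if_neg (by omega)
  refine ⟨m + 1, fun i => if i ≤ m then t i else b + 1, ⟨?_, hlast, fun i hi => ?_⟩,
    fun i hi => ?_⟩
  · rw [hlt (Nat.zero_le _), ht.1]
  · rcases (Nat.lt_succ_iff.1 hi).lt_or_eq with h | rfl
    · rw [hlt h.le, hlt h]
      exact ht.2.2 i h
    · rw [hlt le_rfl, hlast, ht.2.1]
      linarith
  · rcases (Nat.lt_succ_iff.1 hi).lt_or_eq with h | rfl
    · rw [hlt h.le, hlt h]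
      refine (hs i h).congr fun s hs => appendLine_of_le _ _ (hs.2.trans ?_)
      rw [← ht.2.1]
      exact ht.le_of_le h le_rfl
    · rw [hlt le_rfl, hlast, ht.2.1]
      exact (contDiff_segment (γ b) v b).contDiffOn.congr fun s hs => appendLine_of_ge _ _ hs.1

theorem quasiHyperbolicDist_self {Ω : Set (Minkowski n)} {x : Minkowski n} (hx : x ∈ Ω) :
    quasiHyperbolicDist Ω x x = 0 := by
  refine le_antisymm ?_ zero_le
  refine (iInf_le_of_le (fun _ => x) <| iInf_le_of_le 0 <| iInf_le_of_le 0 <| iInf_le_of_le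
    ⟨⟨0, fun _ => 0, ⟨rfl, rfl, by simp⟩, by simp⟩, fun _ _ => hx, rfl, rfl⟩ ?_)
  simp [quasiHyperbolicLength]

-- The two-sided derivative of the concatenated curve is unrelated to those of its pieces at the
-- break point, so that point is discarded as a null set.
open MeasureTheory in
theorem quasiHyperbolicLength_appendLine {Ω : Set (Minkowski n)} {γ : ℝ → Minkowski n} {a b : ℝ}
    (hab : a ≤ b) (z : Minkowski n) :
    quasiHyperbolicLength Ω (appendLine γ b (z - γ b)) a (b + 1) ≤
      quasiHyperbolicLength Ω γ a b + segmentLength Ω (γ b) z := by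
  set v := z - γ b with hv
  set c := appendLine γ b v with hc
  rw [quasiHyperbolicLength, ← Icc_union_Icc_eq_Icc hab (by linarith : b ≤ b + 1)]
  refine (lintegral_union_le _ _ _).trans (add_le_add (le_of_eq ?_) (le_of_eq ?_))
  · rw [quasiHyperbolicLength, setLIntegral_congr Ico_ae_eq_Icc.symm,
      setLIntegral_congr Ico_ae_eq_Icc.symm]
    refine setLIntegral_congr_fun measurableSet_Ico fun s hs => ?_
    have he : c =ᶠ[𝓝 s] γ := by
      filter_upwards [Iio_mem_nhds hs.2] with r hr
      exact appendLine_of_le _ _ (le_of_lt hr)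
    simp only [he.deriv_eq, he.eq_of_nhds]
  · have : Icc b (b + 1) = (fun s => s - b) ⁻¹' Icc 0 1 := by
      rw [preimage_sub_const_Icc, zero_add, add_comm]
    rw [segmentLength, ← (measurePreserving_sub_right volume b).setLIntegral_comp_preimage_emb
      (MeasurableEquiv.subRight b).measurableEmbedding _ (Icc 0 1), ← this,
      setLIntegral_congr Ioc_ae_eq_Icc.symm, setLIntegral_congr Ioc_ae_eq_Icc.symm]
    refine setLIntegral_congr_fun measurableSet_Ioc fun s hs => ?_
    have he : c =ᶠ[𝓝 s] fun s => γ b + (s - b) • v := by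
      filter_upwards [Ioi_mem_nhds hs.1] with r hr
      exact appendLine_of_ge _ _ (le_of_lt hr)
    simp only [he.deriv_eq, he.eq_of_nhds, (hasDerivAt_segment (γ b) v b s).deriv]
    rw [hv]

theorem quasiHyperbolicDist_le_add_segmentLength {Ω : Set (Minkowski n)} (x : Minkowski n)
    {y z : Minkowski n} (hseg : ∀ θ ∈ Icc (0 : ℝ) 1, y + θ • (z - y) ∈ Ω) :
    quasiHyperbolicDist Ω x z ≤ quasiHyperbolicDist Ω x y + segmentLength Ω y z := by
  rw [quasiHyperbolicDist, quasiHyperbolicDist]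
  simp only [ENNReal.iInf_add]
  refine le_iInf fun γ => le_iInf fun a => le_iInf fun b => le_iInf ?_
  rintro ⟨hγ, hmem, hx, rfl⟩
  refine iInf_le_of_le (appendLine γ b (z - γ b)) <| iInf_le_of_le a <| iInf_le_of_le (b + 1) <|
    iInf_le_of_le ⟨hγ.appendLine _, fun s hs => ?_, ?_, ?_⟩
      (quasiHyperbolicLength_appendLine hγ.le z)
  · rcases le_total s b with h | h
    · rw [appendLine_of_le _ _ h]
      exact hmem s ⟨hs.1, h⟩
    · rw [appendLine_of_ge _ _ h]
      exact hseg _ ⟨by linarith, by linarith [hs.2]⟩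
  · rw [appendLine_of_le _ _ hγ.le, hx]
  · rw [appendLine_of_ge _ _ (by linarith)]
    simp

theorem segmentLength_ne_top {Ω : Set (Minkowski n)} (hΩ : IsProperDomain Ω) {x y : Minkowski n}
    (hseg : ∀ θ ∈ Icc (0 : ℝ) 1, x + θ • (y - x) ∈ Ω) : segmentLength Ω x y ≠ ⊤ := by
  have hc : ContinuousOn (fun θ : ℝ => ‖y - x‖ / Metric.infDist (x + θ • (y - x)) (frontier Ω))
      (Icc 0 1) := by
    refine continuousOn_const.div (Continuous.continuousOn ?_) fun θ hθ =>
      (hΩ.infDist_pos (hseg θ hθ)).ne'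
    exact (Metric.continuous_infDist_pt _).comp (by fun_prop)
  exact hc.integrableOn_Icc.lintegral_lt_top.ne

/-- Within a ball contained in `Ω`, segments have finite length, so finiteness of the distance from
`x` passes between the centre and any other point, in both directions; connectedness does the rest.
-/
theorem quasiHyperbolicDist_ne_top {Ω : Set (Minkowski n)} (hΩ : IsProperDomain Ω)
    {x y : Minkowski n} (hx : x ∈ Ω) (hy : y ∈ Ω) : quasiHyperbolicDist Ω x y ≠ ⊤ := by
  have key := hΩ.isConnected.isPreconnected.induction₂'
    (fun y z => quasiHyperbolicDist Ω x y ≠ ⊤ → quasiHyperbolicDist Ω x z ≠ ⊤) (fun y hy => ?_)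
    (fun _ _ _ _ _ _ h h' => h' ∘ h) hx hy
  · exact key (by simp [quasiHyperbolicDist_self hx])
  obtain ⟨r, hr, hb⟩ := Metric.isOpen_iff.1 hΩ.isOpen y hy
  refine mem_nhdsWithin_of_mem_nhds (mem_of_superset (Metric.ball_mem_nhds y hr) fun z hz => ?_)
  have step : ∀ {y' z'}, y' ∈ Metric.ball y r → z' ∈ Metric.ball y r →
      quasiHyperbolicDist Ω x y' ≠ ⊤ → quasiHyperbolicDist Ω x z' ≠ ⊤ := fun {y' z'} hy' hz' h => by
    have hs : ∀ θ ∈ Icc (0 : ℝ) 1, y' + θ • (z' - y') ∈ Ω := fun θ hθ =>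
      hb ((convex_ball y r).add_smul_sub_mem hy' hz' hθ)
    exact ne_top_of_le_ne_top (ENNReal.add_ne_top.2 ⟨h, segmentLength_ne_top hΩ hs⟩)
      (quasiHyperbolicDist_le_add_segmentLength x hs)
  exact ⟨step (Metric.mem_ball_self hr) hz, step hz (Metric.mem_ball_self hr)⟩

theorem lowerConst_mul_quasiHyperbolicDist_le {Ω : Set (Minkowski n)} (hΩ : IsProperDomain Ω)
    (hcc : IsCausallyConvex Ω) {ε : ℝ} (hε : 0 < ε)
    (hfut : IsStablyAcausal ε (futureCausalBoundary Ω))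
    (hpast : IsStablyAcausal ε (pastCausalBoundary Ω)) {x y : Minkowski n} (hx : x ∈ Ω) :
    ENNReal.ofReal (lowerConst ε) * quasiHyperbolicDist Ω x y ≤ markowitzDist Ω x y := by
  refine le_iInf fun m => le_iInf fun γ => le_iInf fun s => le_iInf fun t => le_iInf fun h => ?_
  have step : ∀ k ≤ m, ENNReal.ofReal (lowerConst ε) * quasiHyperbolicDist Ω x (γ k (t k)) ≤
      ENNReal.ofReal (lowerConst ε) * quasiHyperbolicDist Ω x (γ k (s k)) +
        ENNReal.ofReal (intervalDist (s k) (t k)) := fun k hk => by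
    obtain ⟨h₁, h₂⟩ := (h.ppl k hk).segment hΩ hcc hε hfut hpast (h.left_mem k hk)
      (h.right_mem k hk)
    calc _ ≤ ENNReal.ofReal (lowerConst ε) * (quasiHyperbolicDist Ω x (γ k (s k)) +
          segmentLength Ω (γ k (s k)) (γ k (t k))) := by
          gcongr; exact quasiHyperbolicDist_le_add_segmentLength x h₁
      _ ≤ _ := by rw [mul_add]; gcongr
  have key : ∀ k ≤ m, ENNReal.ofReal (lowerConst ε) * quasiHyperbolicDist Ω x (γ k (t k)) ≤
      ∑ i ∈ Finset.range (k + 1), ENNReal.ofReal (intervalDist (s i) (t i)) := fun k => by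
    induction k with
    | zero =>
      intro hk
      simpa [h.source, quasiHyperbolicDist_self hx] using step 0 hk
    | succ k ih =>
      intro hk
      rw [Finset.sum_range_succ]
      refine (step (k + 1) hk).trans ?_
      rw [← h.link k (by omega)]
      gcongr
      exact ih (by omega)
  simpa [h.target] using key m le_rfl

/-! ### Extending lightlike chains and bounding `δ_Ω` inside a Euclidean ball. -/

theorem intervalDist_self {s : ℝ} (hs : s ∈ Ioo (-1 : ℝ) 1) : intervalDist s s = 0 := by
  rw [intervalDist_eq hs hs, sub_self, abs_zero]

theorem IsPPL.markowitzDist_self {Ω : Set (Minkowski n)} {γ : ℝ → Minkowski n} (hγ : IsPPL Ω γ)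
    {s : ℝ} (hs : s ∈ Ioo (-1 : ℝ) 1) : markowitzDist Ω (γ s) (γ s) = 0 := by
  refine le_antisymm ?_ zero_le
  refine iInf_le_of_le 0 <| iInf_le_of_le (fun _ => γ) <| iInf_le_of_le (fun _ => s) <|
    iInf_le_of_le (fun _ => s) <|
    iInf_le_of_le ⟨fun _ _ => hγ, fun _ _ => hs, fun _ _ => hs, rfl, rfl, fun _ _ => rfl⟩ ?_
  simp [intervalDist_self hs]

theorem IsPPL.markowitzDist_le_add {Ω : Set (Minkowski n)} (x : Minkowski n)
    {η : ℝ → Minkowski n} (hη : IsPPL Ω η) {σ τ : ℝ} (hσ : σ ∈ Ioo (-1 : ℝ) 1)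
    (hτ : τ ∈ Ioo (-1 : ℝ) 1) :
    markowitzDist Ω x (η τ) ≤
      markowitzDist Ω x (η σ) + ENNReal.ofReal (intervalDist σ τ) := by
  rw [markowitzDist, markowitzDist]
  simp only [ENNReal.iInf_add]
  refine le_iInf fun m => le_iInf fun γ => le_iInf fun s => le_iInf fun t => le_iInf fun h => ?_
  have hlt : ∀ {k}, k ≤ m → k ≠ m + 1 := fun h => by omega
  refine iInf_le_of_le (m + 1) <| iInf_le_of_le (Function.update γ (m + 1) η) <|
    iInf_le_of_le (Function.update s (m + 1) σ) <| iInf_le_of_le (Function.update t (m + 1) τ) <|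
    iInf_le_of_le ⟨fun k hk => ?_, fun k hk => ?_, fun k hk => ?_, ?_, ?_, fun k hk => ?_⟩ ?_
  · rcases Nat.le_succ_iff.1 hk with h' | rfl
    · simpa [hlt h'] using h.ppl k h'
    · simpa using hη
  · rcases Nat.le_succ_iff.1 hk with h' | rfl
    · simpa [hlt h'] using h.left_mem k h'
    · simpa using hσ
  · rcases Nat.le_succ_iff.1 hk with h' | rfl
    · simpa [hlt h'] using h.right_mem k h'
    · simpa using hτ
  · simpa [hlt (Nat.zero_le m)] using h.source
  · simp
  · rcases (Nat.lt_succ_iff.1 hk).lt_or_eq with h' | rfl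
    · simpa [hlt h'.le, hlt h', h'.ne] using h.link k h'
    · simpa using h.target
  · rw [Finset.sum_range_succ]
    refine add_le_add (le_of_eq (Finset.sum_congr rfl fun k hk => ?_)) (by simp)
    simp [hlt (Nat.lt_succ_iff.1 (Finset.mem_range.1 hk))]

/-- A lightlike diameter of a Euclidean ball, with its affine projective parameter. -/
theorem isPPL_diameter {Ω : Set (Minkowski n)} {y v : Minkowski n} {r : ℝ} (hr : 0 < r)
    (hb : Metric.ball y r ⊆ Ω) (hv : IsLightlike v) :
    IsPPL Ω fun s => y + (s * (r / ‖v‖)) • v := by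
  have hvn : 0 < ‖v‖ := norm_pos_iff.2 hv.1
  set κ := r / ‖v‖ with hκ
  have hκ0 : 0 < κ := by positivity
  have hd : deriv (fun t : ℝ => t / κ) = fun _ => 1 / κ := by
    funext t; exact ((hasDerivAt_id' t).div_const κ).deriv
  have hd2 : iteratedDeriv 2 (fun t : ℝ => t / κ) = fun _ => 0 := by
    rw [iteratedDeriv_succ, iteratedDeriv_one, hd]; funext t; simp
  have hd3 : iteratedDeriv 3 (fun t : ℝ => t / κ) = fun _ => 0 := by
    rw [iteratedDeriv_succ, hd2]; funext t; simp
  refine ⟨y, v, Ioo (-κ) κ, fun t => t / κ, hv, isOpen_Ioo, ordConnected_Ioo, fun t ht => hb ?_,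
    by fun_prop, fun t _ => ?_, fun t _ => ?_, ?_, fun t _ => ?_⟩
  · rw [mem_ball_iff_norm, add_sub_cancel_left, norm_smul, Real.norm_eq_abs, ← lt_div_iff₀ hvn]
    exact abs_lt.2 ht
  · rw [hd]; positivity
  · rw [schwarzian, hd2, hd3]; simp
  · ext s
    constructor
    · rintro ⟨t, ⟨h₁, h₂⟩, rfl⟩
      exact ⟨by rw [lt_div_iff₀ hκ0]; linarith, by rw [div_lt_iff₀ hκ0]; linarith⟩
    · rintro ⟨h₁, h₂⟩
      exact ⟨s * κ, ⟨by nlinarith, by nlinarith⟩, by field_simp⟩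
  · field_simp

theorem intervalDist_zero_le {ρ : ℝ} (hρ : |ρ| < 1) :
    intervalDist 0 ρ ≤ 2 * |ρ| / (1 - |ρ|) := by
  obtain ⟨h₁, h₂⟩ := abs_lt.1 hρ
  rw [intervalDist_eq (by simp) ⟨h₁, h₂⟩]
  simp only [add_zero, sub_zero, Real.log_one]
  have h3 : 0 < 1 + ρ := by linarith
  have h4 : 0 < 1 - ρ := by linarith
  have bound : ∀ {r : ℝ}, 0 ≤ r → r < 1 →
      0 ≤ Real.log (1 + r) - Real.log (1 - r) ∧
        Real.log (1 + r) - Real.log (1 - r) ≤ 2 * r / (1 - r) := fun {r} h0 h1 => by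
    have h5 : 0 < 1 - r := by linarith
    refine ⟨sub_nonneg.2 (Real.log_le_log h5 (by linarith)), ?_⟩
    rw [← Real.log_div (by linarith) (by linarith)]
    refine (Real.log_le_sub_one_of_pos (by positivity)).trans (le_of_eq ?_)
    field_simp
    ring
  rcases le_total 0 ρ with h | h
  · obtain ⟨b₁, b₂⟩ := bound h h₂
    rwa [abs_of_nonneg b₁, abs_of_nonneg h]
  · obtain ⟨b₁, b₂⟩ := bound (neg_nonneg.2 h) (by linarith)
    rw [← sub_eq_add_neg, sub_neg_eq_add] at b₁ b₂
    rw [abs_sub_comm, abs_of_nonneg b₁, abs_of_nonpos h, sub_neg_eq_add]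
    exact b₂

theorem markowitzDist_add_smul_le {Ω : Set (Minkowski n)} (x : Minkowski n) {y v : Minkowski n}
    {r : ℝ} (hb : Metric.ball y r ⊆ Ω) (hv : IsLightlike v) (hvn : ‖v‖ = √2) {α : ℝ}
    (hα : √2 * |α| < r) :
    markowitzDist Ω x (y + α • v) ≤
      markowitzDist Ω x y + ENNReal.ofReal (2 * √2 * |α| / (r - √2 * |α|)) := by
  have hr : 0 < r := lt_of_le_of_lt (by positivity) hα
  have h2 : 0 < √2 := by positivity
  have hρ : |α * √2 / r| = √2 * |α| / r := by
    rw [abs_div, abs_mul, abs_of_pos hr, abs_of_pos h2, mul_comm]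
  have hρ1 : |α * √2 / r| < 1 := by rw [hρ, div_lt_one hr]; exact hα
  have h := (isPPL_diameter hr hb hv).markowitzDist_le_add x (σ := 0) (τ := α * √2 / r) (by simp)
    (abs_lt.1 hρ1)
  have e : α * √2 / r * (r / ‖v‖) = α := by rw [hvn]; field_simp
  rw [e, zero_mul, zero_smul, add_zero] at h
  refine h.trans ?_
  gcongr
  refine (intervalDist_zero_le hρ1).trans (le_of_eq ?_)
  rw [hρ]
  have : r - √2 * |α| ≠ 0 := by linarith
  have h3 : 1 - √2 * |α| / r ≠ 0 := by rw [one_sub_div hr.ne']; exact div_ne_zero this hr.ne'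
  field_simp

theorem isLightlike_of_norm_eq_one {e : EuclideanSpace ℝ (Fin n)} (he : ‖e‖ = 1) :
    IsLightlike (WithLp.toLp 2 ((1 : ℝ), e)) := by
  refine ⟨fun h => ?_, ?_⟩
  · have := congrArg WithLp.fst h
    simp at this
  · rw [form_self]
    simp [he]

/-- A purely vertical displacement, `q = 0`, also needs a spatial direction to be split into
lightlike vectors. -/
theorem exists_unit_smul_eq (hn : 1 ≤ n) (q : EuclideanSpace ℝ (Fin n)) :
    ∃ e : EuclideanSpace ℝ (Fin n), ‖e‖ = 1 ∧ q = ‖q‖ • e := by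
  rcases eq_or_ne q 0 with rfl | hq
  · exact ⟨EuclideanSpace.single ⟨0, hn⟩ 1, by simp, by simp⟩
  · have h := norm_ne_zero_iff.2 hq
    exact ⟨‖q‖⁻¹ • q, by rw [norm_smul, norm_inv, norm_norm, inv_mul_cancel₀ h],
      by rw [smul_smul, mul_inv_cancel₀ h, one_smul]⟩

theorem markowitzDist_self (hn : 1 ≤ n) {Ω : Set (Minkowski n)} (hΩ : IsOpen Ω) {x : Minkowski n}
    (hx : x ∈ Ω) : markowitzDist Ω x x = 0 := by
  obtain ⟨r, hr, hb⟩ := Metric.isOpen_iff.1 hΩ x hx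
  obtain ⟨e, he, -⟩ := exists_unit_smul_eq hn 0
  simpa using (isPPL_diameter hr hb (isLightlike_of_norm_eq_one he)).markowitzDist_self
    (s := 0) (by simp)

/-- The displacement is a combination of `(1, e)` and `(1, -e)`, both of norm `√2`. Two diameters
suffice: one in the given ball, then one in the smaller ball about the intermediate point. -/
theorem markowitzDist_le_add_of_ball (hn : 1 ≤ n) {Ω : Set (Minkowski n)} (x : Minkowski n)
    {z w : Minkowski n} {r : ℝ} (hb : Metric.ball z r ⊆ Ω) (hr : √2 * ‖w - z‖ < r) :
    markowitzDist Ω x w ≤ markowitzDist Ω x z +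
      ENNReal.ofReal (2 * √2 * ‖w - z‖ / (r - √2 * ‖w - z‖)) := by
  obtain ⟨e, he, hq⟩ := exists_unit_smul_eq hn (w - z).snd
  have hsq := norm_sq_eq (w - z)
  set h := ‖w - z‖
  set τ := (w - z).fst with hτ
  set ρ := ‖(w - z).snd‖ with hρ
  have hρ0 : 0 ≤ ρ := norm_nonneg _
  have hh0 : 0 ≤ h := norm_nonneg _
  set α := (τ + ρ) / 2 with hα
  set β := (τ - ρ) / 2 with hβ
  set v₁ : Minkowski n := WithLp.toLp 2 (1, e) with hv₁
  set v₂ : Minkowski n := WithLp.toLp 2 (1, -e) with hv₂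
  have l₁ : IsLightlike v₁ := isLightlike_of_norm_eq_one he
  have l₂ : IsLightlike v₂ := isLightlike_of_norm_eq_one (by rwa [norm_neg])
  have n₁ : ‖v₁‖ = √2 := by rw [l₁.norm_eq, hv₁]; simp
  have n₂ : ‖v₂‖ = √2 := by rw [l₂.norm_eq, hv₂]; simp
  have hw : w = z + α • v₁ + β • v₂ := by
    have : w - z = α • v₁ + β • v₂ := by
      refine ext_fst_snd ?_ ?_
      · rw [← hτ]; simp [hv₁, hv₂, hα, hβ]; ring
      · rw [hq]; simp only [hv₁, hv₂, WithLp.add_snd, WithLp.smul_snd, WithLp.toLp_snd, hα, hβ]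
        module
    rw [add_assoc, ← this, add_sub_cancel]
  -- In fact `|α| + |β| = max |τ| ρ`.
  have hsum : |α| + |β| ≤ h := by
    have h1 : |τ| ≤ h := abs_le_of_sq_le_sq (by nlinarith [sq_nonneg ρ]) hh0
    have h2 : ρ ≤ h := 
      (sq_le_sq₀ hρ0 hh0).1 (by nlinarith [sq_nonneg τ])
    obtain ⟨h3, h4⟩ := abs_le.1 h1
    rcases abs_cases α with ⟨ha, _⟩ | ⟨ha, _⟩ <;> rcases abs_cases β with ⟨hb', _⟩ | ⟨hb', _⟩ <;>
      rw [ha, hb'] <;> linarith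
  have h2 : 0 < √2 := by positivity
  have a0 := abs_nonneg α
  have b0 := abs_nonneg β
  have hs2 : √2 * |α| + √2 * |β| ≤ √2 * h := by
    rw [← mul_add]; exact mul_le_mul_of_nonneg_left hsum h2.le
  have p1 : 0 ≤ √2 * |α| := by positivity
  have p2 : 0 ≤ √2 * |β| := by positivity
  have s₁ := markowitzDist_add_smul_le x hb l₁ n₁ (α := α) (by linarith)
  have hb' : Metric.ball (z + α • v₁) (r - √2 * |α|) ⊆ Ω := by
    refine (Metric.ball_subset_ball' ?_).trans hb
    rw [dist_eq_norm, add_sub_cancel_left, norm_smul, n₁, Real.norm_eq_abs]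
    linarith
  have s₂ := markowitzDist_add_smul_le x hb' l₂ n₂ (α := β) (by linarith)
  rw [← hw] at s₂
  refine s₂.trans ((add_le_add_left s₁ _).trans ?_)
  have d₁ : 0 < r - √2 * h := by linarith
  rw [add_assoc, ← ENNReal.ofReal_add (div_nonneg (by positivity) (by linarith))
    (div_nonneg (by positivity) (by linarith))]
  gcongr
  calc _ ≤ 2 * √2 * |α| / (r - √2 * h) + 2 * √2 * |β| / (r - √2 * h) := by
        refine add_le_add ?_ ?_ <;>
          exact div_le_div_of_nonneg_left (by positivity) d₁ (by linarith)
    _ = 2 * √2 * (|α| + |β|) / (r - √2 * h) := by ring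
    _ ≤ _ := by gcongr

theorem markowitzDist_ne_top (hn : 1 ≤ n) {Ω : Set (Minkowski n)} (hΩ : IsProperDomain Ω)
    {x y : Minkowski n} (hx : x ∈ Ω) (hy : y ∈ Ω) : markowitzDist Ω x y ≠ ⊤ := by
  have key := hΩ.isConnected.isPreconnected.induction₂'
    (fun y z => markowitzDist Ω x y ≠ ⊤ → markowitzDist Ω x z ≠ ⊤) (fun y hy => ?_)
    (fun _ _ _ _ _ _ h h' => h' ∘ h) hx hy
  · exact key (by simp [markowitzDist_self hn hΩ.isOpen hx])
  obtain ⟨r, hr, hb⟩ := Metric.isOpen_iff.1 hΩ.isOpen y hy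
  refine mem_nhdsWithin_of_mem_nhds
    (mem_of_superset (Metric.ball_mem_nhds y (by positivity : 0 < r / 4)) fun z hz => ?_)
  rw [mem_ball_iff_norm] at hz
  have h2 : √2 < 2 := by rw [Real.sqrt_lt' (by norm_num)]; norm_num
  have hz' : √2 * ‖z - y‖ ≤ 2 * ‖z - y‖ := by gcongr
  refine ⟨fun h => ne_top_of_le_ne_top (ENNReal.add_ne_top.2 ⟨h, ENNReal.ofReal_ne_top⟩)
      (markowitzDist_le_add_of_ball hn x hb (by linarith)), fun h =>
    ne_top_of_le_ne_top (ENNReal.add_ne_top.2 ⟨h, ENNReal.ofReal_ne_top⟩)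
      (markowitzDist_le_add_of_ball hn x (r := r / 2) ((Metric.ball_subset_ball' ?_).trans hb) ?_)⟩
  · rw [dist_eq_norm]; linarith
  · rw [norm_sub_rev]; linarith

/-! ### Integration of the local upper bound along curves. -/

theorem toReal_markowitzDist_le (hn : 1 ≤ n) {Ω : Set (Minkowski n)} (hΩ : IsProperDomain Ω)
    {x z w : Minkowski n} (hx : x ∈ Ω) (hz : z ∈ Ω) {r : ℝ}
    (hb : Metric.ball z r ⊆ Ω) (hr : √2 * ‖w - z‖ < r) :
    (markowitzDist Ω x w).toReal ≤ (markowitzDist Ω x z).toReal +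
      2 * √2 * ‖w - z‖ / (r - √2 * ‖w - z‖) := by
  have h := markowitzDist_le_add_of_ball hn x hb hr
  have hz' := markowitzDist_ne_top hn hΩ hx hz
  have := ENNReal.toReal_mono (ENNReal.add_ne_top.2 ⟨hz', ENNReal.ofReal_ne_top⟩) h
  rwa [ENNReal.toReal_add hz' ENNReal.ofReal_ne_top, ENNReal.toReal_ofReal
    (div_nonneg (by positivity) (by linarith))] at this

theorem continuousOn_markowitzDist (hn : 1 ≤ n) {Ω : Set (Minkowski n)} (hΩ : IsProperDomain Ω)
    {x : Minkowski n} (hx : x ∈ Ω) : ContinuousOn (fun z => (markowitzDist Ω x z).toReal) Ω := by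
  intro z hz
  refine ContinuousAt.continuousWithinAt ?_
  obtain ⟨r, hr, hb⟩ := Metric.isOpen_iff.1 hΩ.isOpen z hz
  rw [ContinuousAt, tendsto_iff_dist_tendsto_zero]
  -- The ball estimate is used from `z` to `w`, and back from `w` with radius `r - ‖w - z‖`; the
  -- coefficient `3` dominates `1 + √2`.
  refine squeeze_zero' (g := fun w => 2 * √2 * ‖w - z‖ / (r - 3 * ‖w - z‖))
    (Eventually.of_forall fun _ => dist_nonneg) ?_ ?_
  · filter_upwards [Metric.ball_mem_nhds z (by positivity : 0 < r / 4)] with w hw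
    have hwb : w ∈ Ω := hb (Metric.ball_subset_ball (by linarith) hw)
    rw [mem_ball_iff_norm] at hw
    have h2 : √2 < 2 := by rw [Real.sqrt_lt' (by norm_num)]; norm_num
    have h0 := norm_nonneg (w - z)
    have hw' : √2 * ‖w - z‖ ≤ 2 * ‖w - z‖ := by gcongr
    have e₁ := toReal_markowitzDist_le hn hΩ hx hz hb (w := w) (by linarith)
    have e₂ := toReal_markowitzDist_le hn hΩ hx hwb (r := r - ‖w - z‖) (w := z)
      ((Metric.ball_subset_ball' (by rw [dist_eq_norm]; linarith)).trans hb)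
      (by rw [norm_sub_rev z w]; linarith)
    rw [norm_sub_rev z w] at e₂
    have f₁ : 2 * √2 * ‖w - z‖ / (r - √2 * ‖w - z‖) ≤ 2 * √2 * ‖w - z‖ / (r - 3 * ‖w - z‖) := by
      gcongr <;> linarith
    have f₂ : 2 * √2 * ‖w - z‖ / (r - ‖w - z‖ - √2 * ‖w - z‖) ≤
        2 * √2 * ‖w - z‖ / (r - 3 * ‖w - z‖) := by
      refine div_le_div_of_nonneg_left (by positivity) ?_ ?_ <;> linarith
    rw [Real.dist_eq, abs_le]
    constructor <;> linarith
  · have : ContinuousAt (fun w : Minkowski n => 2 * √2 * ‖w - z‖ / (r - 3 * ‖w - z‖)) z :=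
      ContinuousAt.div (by fun_prop) (by fun_prop) (by simpa using hr.ne')
    simpa [ContinuousAt] using this

-- By the ball estimate at `γ s` with radius `d_h(γ s, ∂Ω)`, the upper right slope of `f` is at most
-- `2√2` times the quasi-hyperbolic speed. Since `f` is continuous, it stays below the primitive of
-- that bound.
open MeasureTheory in
theorem markowitzDist_le_add_length (hn : 1 ≤ n) {Ω : Set (Minkowski n)} (hΩ : IsProperDomain Ω)
    {x : Minkowski n} (hx : x ∈ Ω) {γ : ℝ → Minkowski n} {a b : ℝ} (hab : a < b)
    (hγ : ContDiffOn ℝ ∞ γ (Icc a b)) (hmem : ∀ s ∈ Icc a b, γ s ∈ Ω) :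
    markowitzDist Ω x (γ b) ≤ markowitzDist Ω x (γ a) +
      ENNReal.ofReal (2 * √2) * quasiHyperbolicLength Ω γ a b := by
  set f : ℝ → ℝ := fun s => (markowitzDist Ω x (γ s)).toReal with hf
  set D : ℝ → ℝ := fun s => Metric.infDist (γ s) (frontier Ω) with hD
  have hDpos : ∀ s ∈ Icc a b, 0 < D s := fun s hs => hΩ.infDist_pos (hmem s hs)
  set φ : ℝ → ℝ := fun s => 2 * √2 * (‖derivWithin γ (Icc a b) s‖ / D s) with hφ
  have hφc : ContinuousOn φ (Icc a b) := by
    refine continuousOn_const.mul (ContinuousOn.div ?_ ?_ fun s hs => (hDpos s hs).ne')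
    · exact (hγ.continuousOn_derivWithin (uniqueDiffOn_Icc hab) (by simp)).norm
    · exact (Metric.continuous_infDist_pt _).comp_continuousOn hγ.continuousOn
  -- A continuous extension to the whole line makes the primitive differentiable everywhere,
  -- including at `a` and `b`.
  set G : ℝ → ℝ := IccExtend hab.le ((Icc a b).domRestrict φ) with hG
  have hGc : Continuous G := hφc.domRestrict.Icc_extend'
  have hGφ : ∀ s ∈ Icc a b, G s = φ s := fun s hs => IccExtend_of_mem _ _ hs
  have hB : ∀ s, HasDerivAt (fun s => f a + ∫ θ in a..s, G θ) (G s) s := fun s =>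
    (intervalIntegral.integral_hasDerivAt_right (hGc.intervalIntegrable _ _)
      (hGc.stronglyMeasurableAtFilter _ _) hGc.continuousAt).const_add _
  have hle : f b ≤ f a + ∫ θ in a..b, G θ := by
    refine image_le_of_liminf_slope_right_le_deriv_boundary
      (f := f) (B := fun s => f a + ∫ θ in a..s, G θ) (B' := G)
      ((continuousOn_markowitzDist hn hΩ hx).comp hγ.continuousOn hmem) (by simp)
      (fun s _ => (hB s).continuousAt.continuousWithinAt) (fun s _ => (hB s).hasDerivWithinAt)
      (fun s hs r hr => ?_) (right_mem_Icc.2 hab.le)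
    have hs' : s ∈ Icc a b := Ico_subset_Icc_self hs
    rw [hGφ s hs'] at hr
    have hder : HasDerivWithinAt γ (derivWithin γ (Icc a b) s) (Ioi s) s := by
      refine (((hγ s hs').differentiableWithinAt (by simp)).hasDerivWithinAt).mono_of_mem_nhdsWithin
        ?_
      exact mem_of_superset (Ioc_mem_nhdsGT hs.2) fun y hy => ⟨hs.1.trans hy.1.le, hy.2⟩
    have hslope : Tendsto (fun z => ‖slope γ s z‖) (𝓝[>] s) (𝓝 ‖derivWithin γ (Icc a b) s‖) :=
      ((hasDerivWithinAt_iff_tendsto_slope' (by simp)).1 hder).norm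
    have hdist : Tendsto (fun z => √2 * ‖γ z - γ s‖) (𝓝[>] s) (𝓝 0) := by
      have h1 : Tendsto γ (𝓝[>] s) (𝓝 (γ s)) := hder.continuousWithinAt
      simpa using ((h1.sub_const (γ s)).norm).const_mul √2
    have hlim : Tendsto (fun z => 2 * √2 * (‖slope γ s z‖ / (D s - √2 * ‖γ z - γ s‖))) (𝓝[>] s)
        (𝓝 (φ s)) := by
      refine (hslope.div (hdist.const_sub (D s)) ?_).const_mul (2 * √2) |>.congr' ?_ |>.trans ?_
      · simpa using (hDpos s hs').ne'
      · exact Eventually.of_forall fun _ => rfl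
      · rw [sub_zero]
    refine Eventually.frequently ?_
    filter_upwards [hlim.eventually (gt_mem_nhds hr),
      hdist.eventually (gt_mem_nhds (hDpos s hs')), self_mem_nhdsWithin] with z hz hzD hsz
    refine lt_of_le_of_lt ?_ hz
    have hzs : 0 < z - s := sub_pos.2 hsz
    have key := toReal_markowitzDist_le hn hΩ hx (hmem s hs')
      (ball_infDist_frontier_subset hΩ.isOpen (hmem s hs')) hzD
    rw [slope_def_field, div_le_iff₀ hzs, slope_def_module, norm_smul, norm_inv, Real.norm_eq_abs,
      abs_of_pos hzs]
    have e : 2 * √2 * ((z - s)⁻¹ * ‖γ z - γ s‖ / (D s - √2 * ‖γ z - γ s‖)) * (z - s) =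
        2 * √2 * ‖γ z - γ s‖ / (D s - √2 * ‖γ z - γ s‖) := by
      field_simp
    rw [e]
    simp only [hf]
    linarith
  have hint : ENNReal.ofReal (2 * √2) * quasiHyperbolicLength Ω γ a b =
      ENNReal.ofReal (∫ θ in a..b, G θ) := by
    rw [quasiHyperbolicLength, ← lintegral_const_mul' _ _ ENNReal.ofReal_ne_top,
      intervalIntegral.integral_of_le hab.le, ← integral_Icc_eq_integral_Ioc,
      ofReal_integral_eq_lintegral_ofReal hGc.continuousOn.integrableOn_Icc
        (ae_restrict_of_forall_mem measurableSet_Icc fun θ hθ => by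
          rw [hGφ θ hθ]
          have := hDpos θ hθ
          simp only [hφ, Pi.zero_apply]
          positivity),
      setLIntegral_congr Ioo_ae_eq_Icc.symm, setLIntegral_congr Ioo_ae_eq_Icc.symm]
    refine setLIntegral_congr_fun measurableSet_Ioo fun θ hθ => ?_
    simp only [hGφ θ (Ioo_subset_Icc_self hθ), hφ]
    rw [← ENNReal.ofReal_mul (by positivity), derivWithin_of_mem_nhds (Icc_mem_nhds hθ.1 hθ.2)]
  have hfa := markowitzDist_ne_top hn hΩ hx (hmem a (left_mem_Icc.2 hab.le))
  have hfb := markowitzDist_ne_top hn hΩ hx (hmem b (right_mem_Icc.2 hab.le))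
  rw [hint, ← ENNReal.ofReal_toReal hfb]
  refine (ENNReal.ofReal_le_ofReal hle).trans (ENNReal.ofReal_add_le.trans ?_)
  rw [hf, ENNReal.ofReal_toReal hfa]

theorem quasiHyperbolicLength_add_le {Ω : Set (Minkowski n)} (γ : ℝ → Minkowski n) {a b c : ℝ}
    (hab : a ≤ b) (hbc : b ≤ c) :
    quasiHyperbolicLength Ω γ a b + quasiHyperbolicLength Ω γ b c ≤
      quasiHyperbolicLength Ω γ a c := by
  have hd : Disjoint (Icc a b) (Ioc b c) := disjoint_left.2 fun s hs hs' => hs'.1.not_ge hs.2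
  rw [quasiHyperbolicLength, quasiHyperbolicLength, quasiHyperbolicLength,
    MeasureTheory.setLIntegral_congr (MeasureTheory.Ioc_ae_eq_Icc (a := b) (b := c)).symm,
    ← MeasureTheory.lintegral_union measurableSet_Ioc hd, Icc_union_Ioc_eq_Icc hab hbc]

theorem markowitzDist_le_quasiHyperbolicDist (hn : 1 ≤ n) {Ω : Set (Minkowski n)}
    (hΩ : IsProperDomain Ω) {x y : Minkowski n} (hx : x ∈ Ω) :
    markowitzDist Ω x y ≤ ENNReal.ofReal (2 * √2) * quasiHyperbolicDist Ω x y := by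
  rw [quasiHyperbolicDist]
  simp only [ENNReal.mul_iInf_of_ne (ENNReal.ofReal_pos.2 (by positivity : 0 < 2 * √2)).ne'
    ENNReal.ofReal_ne_top]
  refine le_iInf fun γ => le_iInf fun a => le_iInf fun b => le_iInf ?_
  rintro ⟨⟨m, t, ht, hs⟩, hmem, rfl, rfl⟩
  have key : ∀ i ≤ m, markowitzDist Ω (γ a) (γ (t i)) ≤
      ENNReal.ofReal (2 * √2) * quasiHyperbolicLength Ω γ a (t i) := fun i => by
    induction i with
    | zero =>
      intro _
      rw [ht.1, markowitzDist_self hn hΩ.isOpen hx]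
      exact zero_le
    | succ i ih =>
      intro hi
      have h₀ : a ≤ t i := by rw [← ht.1]; exact ht.le_of_le (Nat.zero_le _) (by omega)
      have h₁ : t (i + 1) ≤ b := by rw [← ht.2.1]; exact ht.le_of_le hi le_rfl
      have hlt := ht.2.2 i hi
      calc _ ≤ markowitzDist Ω (γ a) (γ (t i)) +
            ENNReal.ofReal (2 * √2) * quasiHyperbolicLength Ω γ (t i) (t (i + 1)) :=
            markowitzDist_le_add_length hn hΩ hx hlt (hs i hi)
              fun s hs => hmem s ⟨h₀.trans hs.1, hs.2.trans h₁⟩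
        _ ≤ ENNReal.ofReal (2 * √2) * quasiHyperbolicLength Ω γ a (t i) +
            ENNReal.ofReal (2 * √2) * quasiHyperbolicLength Ω γ (t i) (t (i + 1)) := by
            gcongr; exact ih (by omega)
        _ ≤ _ := by
            rw [← mul_add]; gcongr; exact quasiHyperbolicLength_add_le γ h₀ hlt.le
  have := key m le_rfl
  rwa [ht.2.1] at this

end Minkowski

end

theorem mainTheorem6 (n : ℕ) (hn : 1 ≤ n) (Ω : Set (Minkowski n))
    (hΩ : Minkowski.IsProperDomain Ω) (hcc : Minkowski.IsCausallyConvex Ω)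
    (ε : ℝ) (hε : 0 < ε)
    (hfut : Minkowski.IsStablyAcausal ε (Minkowski.futureCausalBoundary Ω))
    (hpast : Minkowski.IsStablyAcausal ε (Minkowski.pastCausalBoundary Ω))
    (x : Minkowski n) (hx : x ∈ Ω) (y : Minkowski n) (hy : y ∈ Ω) :
    Minkowski.quasiHyperbolicDist Ω x y ≠ ⊤ ∧
    Minkowski.markowitzDist Ω x y ≠ ⊤ ∧
    ENNReal.ofReal (ε / Real.sqrt ((2 + ε) ^ 2 + ε ^ 2)) * Minkowski.quasiHyperbolicDist Ω x y
      ≤ Minkowski.markowitzDist Ω x y ∧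
    Minkowski.markowitzDist Ω x y
      ≤ ENNReal.ofReal (2 * Real.sqrt 2) * Minkowski.quasiHyperbolicDist Ω x y :=
  ⟨Minkowski.quasiHyperbolicDist_ne_top hΩ hx hy, Minkowski.markowitzDist_ne_top hn hΩ hx hy,
    Minkowski.lowerConst_mul_quasiHyperbolicDist_le hΩ hcc hε hfut hpast hx,
    Minkowski.markowitzDist_le_quasiHyperbolicDist hn hΩ hx⟩
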